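/- **Setting.** Fix $n\ge 1$, write $[n]=\{1,\dots,n\}$, and let $\lambda=(\lambda_1\ge\dots\ge\lambda_n\ge 0)$ be a partition, with column lengths $\zeta_1\ge\dots\ge\zeta_{\lambda_1}$. Let $R=R_\lambda=\{q_1<\dots<q_r\}$ be the set of its distinct column lengths less than $n$, and put $q_0=0$, $q_{r+1}=n$. The carrels are the intervals $(q_{h-1},q_h]$, $1\le h\le r+1$. A tuple is a map $\nu:[n]\to[n]$. It is *upper* if $\nu_i\ge i$ for all $i$, an *upper flag* if moreover $\nu_1\le\dots\le\nu_n$, and *$\lambda$-increasing* if it is strictly increasing on each carrel. A *$\lambda$-permutation* is a $\lambda$-increasing permutation $\pi$ of $[n]$. It is *$\lambda$-312-avoiding* if there are no $h\le r-1$ and $a\le q_h<b\le q_{h+1}<c$ with $\pi_b<\pi_c<\pi_a$. A *gapless $\lambda$-tuple* is a $\lambda$-increasing upper tuple $\gamma$ such that, whenever $1\le h\le r$ and $\gamma_{q_h}>\gamma_{q_h+1}$, the number $s=\gamma_{q_h}-\gamma_{q_h+1}+1$ is at most $q_{h+1}-q_h$ and the first $s$ entries of $\gamma$ on $(q_h,q_{h+1}]$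 are $\gamma_{q_h}-s+1,\dots,\gamma_{q_h}$. Write $\mathrm{rank}^d(Q)$ for the $d$-th largest element of $Q$. **Maps.** * $\Psi_\lambda$: for a $\lambda$-permutation $\pi$ and $i\in(q_{h-1},q_h]$, $\Psi_\lambda(\pi)_i=\mathrm{rank}^{q_h-i+1}\{\pi_1,\dots,\pi_{q_h}\}$. * $\Delta_\lambda$: let $\upsilon$ be an upper tuple. In the carrel $(q_{h-1},q_h]$ the index $q_h$ is critical, and if $x'$ is critical then the next critical index to the left is the largest $x<x'$ in the carrel with $\upsilon_{x'}-\upsilon_x>x'-x$, if there is one. For each $i$ put $\Delta_\lambda(\upsilon)_i=\upsilon_x-(x-i)$, where $x$ is the smallest critical index $\ge i$. An upper tuple $\eta$ is a *gapless core $\lambda$-tuple* if $\Delta_\lambda(\eta)$ is gapless. * $\Pi_\lambda$: for a gapless $\lambda$-tuple $\gamma$ define $\pi=\Pi_\lambda(\gamma)$ by $\pi_i=\gamma_i$ for $i\le q_1$; for $1\le h\le r$ let $s=\gamma_{q_h}-\gamma_{q_h+1}+1$ if $\gamma_{q_h}\ge\gamma_{q_h+1}$ and $s=0$ otherwise, and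 put $\pi_i=\mathrm{rank}^{q_h+s-i+1}\big([\gamma_{q_h}]\setminus\{\pi_1,\dots,\pi_{q_h}\}\big)$ for $q_h<i\le q_h+s$ and $\pi_i=\gamma_i$ for $q_h+s<i\le q_{h+1}$. **Tableaux and polynomials.** Let $\mathcal T_\lambda$ be the set of semistandard tableaux of shape $\lambda$ with entries in $[n]$, with $T_j(i)$ the entry in column $j$ and row $i$. For an upper tuple $\beta$ let $\mathcal S_\lambda(\beta)$ be the set of $T\in\mathcal T_\lambda$ all of whose entries in row $i$ are at most $\beta_i$, for each $i$. For a $\lambda$-permutation $\pi$ let $Y_\lambda(\pi)\in\mathcal T_\lambda$ be the tableau in which each column of length $q$ has the set of entries $\{\pi_1,\dots,\pi_q\}$. The earliest weakly increasing subsequence of a sequence is its first term, followed by the first later term that is at least as large, and so on. The *scanning tableau* $S(T)$ of $T$ is formed as follows: for each $j$, delete the columns to the left of column $j$ from $T$; then repeatedly take the earliest weakly increasing subsequence of the sequence of bottom entries of the nonempty columns (from left to right), write its last term into the lowest empty box of column $j$ of $S(T)$, and remove the boxes of the subsequence, until column $j$ of $S(T)$ is full. Let $\mathcal D_\lambda(\pi)=\{T\in\mathcal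 T_\lambda: S(T)\le Y_\lambda(\pi)\text{ entrywise}\}$. Let $x^{\Theta(T)}=\prod_v x_v^{\#\{\text{entries of }T\text{ equal to }v\}}$, and put $$s_\lambda(\beta;x)=\sum_{T\in\mathcal S_\lambda(\beta)}x^{\Theta(T)},\qquad d_\lambda(\pi;x)=\sum_{T\in\mathcal D_\lambda(\pi)}x^{\Theta(T)}.$$ The $d_\lambda(\pi;x)$ are the *Demazure polynomials*, and the $s_\lambda(\varphi;x)$ with $\varphi$ an upper flag are the *flag Schur polynomials*. Two such sums are *identical*, written $\equiv$, if their shapes and their sets of tableaux coincide (so in particular they are equal as polynomials). **Theorem.** (i) If $\eta$ is a gapless core $\lambda$-tuple, then $\pi:=\Pi_\lambda(\Delta_\lambda(\eta))$ is a $\lambda$-312-avoiding $\lambda$-permutation and $s_\lambda(\eta;x)\equiv d_\lambda(\pi;x)$. (ii) If $\pi$ is a $\lambda$-312-avoiding $\lambda$-permutation, then $\gamma:=\Psi_\lambda(\pi)$ is a gapless $\lambda$-tuple and $d_\lambda(\pi;x)\equiv s_\lambda(\gamma;x)$. (iii) For every upper flag $\varphi$ there is exactly one pair $(\lambda',\pi)$,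 with $\lambda'$ a partition with at most $n$ parts and $\pi$ a $\lambda'$-permutation, such that $s_\lambda(\varphi;x)\equiv d_{\lambda'}(\pi;x)$. For every $\lambda$-312-avoiding $\lambda$-permutation $\pi$ there is an upper flag $\varphi$ with $d_\lambda(\pi;x)\equiv s_\lambda(\varphi;x)$, and this flag Schur polynomial is uniquely determined: if $d_\lambda(\pi;x)\equiv s_{\lambda'}(\varphi';x)$ for a partition $\lambda'$ with at most $n$ parts and an upper flag $\varphi'$, then $\lambda'=\lambda$ and $\Delta_\lambda(\varphi')=\Delta_\lambda(\varphi)$. -/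

import Mathlib

/-!
Conventions.  All indices and values are shifted down by one: the set `[n] = {1, ..., n}` is
`Fin n`, so that the index (or value) `k` of the usual notation is `k - 1` here.  An `nn`-tuple is a
function `Fin n → Fin n`.

A set of dividers `R ⊆ {1, ..., n - 1}` is a `Finset ℕ`.  If its elements are
`q_1 < ... < q_r` and `q_0 = 0`, `q_{r+1} = n`, then the carrels `(q_{h-1}, q_h]` become, after
the shift, the blocks `{i | q_{h-1} ≤ i < q_h}`.

A partition with at most `n` parts is a `YoungDiagram` whose first column has length at most `n`.
-/

namespace FlagDemazure

open Finset

section Tuples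

variable {n : ℕ}

/-- The divider `q_{h-1}` at the left of the carrel containing the index `i`; after the shift it is
the first index of that carrel. -/
def carrelStart (R : Finset ℕ) (i : ℕ) : ℕ := (R.filter (fun q => q ≤ i)).sup id

/-- The divider `q_h` at the right of the carrel containing the index `i`; after the shift it is
one more than the last index of that carrel. -/
def carrelEnd (R : Finset ℕ) (n i : ℕ) : ℕ :=
  (insert n (R.filter (fun q => i < q))).min' (Finset.insert_nonempty _ _)

theorem carrelStart_le (R : Finset ℕ) (i : ℕ) : carrelStart R i ≤ i :=
  Finset.sup_le (fun _ hq => (Finset.mem_filter.mp hq).2)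

/-- Two indices lie in the same carrel. -/
def SameCarrel (R : Finset ℕ) (i j : ℕ) : Prop := carrelStart R i = carrelStart R j

/-- `rank^d(Q)`: the `d`-th largest element of `Q`, for `1 ≤ d ≤ |Q|`. -/
def rank {α : Type} [LinearOrder α] [Inhabited α] (Q : Finset α) (d : ℕ) : α :=
  (Q.sort (fun a b => b ≤ a)).getD (d - 1) default

/-- Upper tuples: `υ_i ≥ i`. -/
def IsUpper (ν : Fin n → Fin n) : Prop := ∀ i, i ≤ ν i

/-- Upper flags: weakly increasing upper tuples. -/
def IsUpperFlag (ν : Fin n → Fin n) : Prop := IsUpper ν ∧ Monotone ν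

/-- `R`-increasing tuples: strictly increasing on each carrel. -/
def IsRIncreasing (R : Finset ℕ) (ν : Fin n → Fin n) : Prop :=
  ∀ i j : Fin n, i < j → SameCarrel R i j → ν i < ν j

/-- `R`-permutations. -/
def IsRPerm (R : Finset ℕ) (π : Fin n → Fin n) : Prop :=
  Function.Injective π ∧ IsRIncreasing R π

/-- The pattern 312 occurs blockwise: `π_b < π_c < π_a` with `a`, `b`, `c` in three different
carrels, from left to right (`q` and `q'` can be taken to be the dividers that bound the carrel
of `b`). -/
def Contains312 (R : Finset ℕ) (π : Fin n → Fin n) : Prop :=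
  ∃ q ∈ R, ∃ q' ∈ R, ∃ a b c : Fin n,
    (a : ℕ) < q ∧ q ≤ b ∧ (b : ℕ) < q' ∧ q' ≤ c ∧ π b < π c ∧ π c < π a

/-- `R`-312-avoiding `R`-permutations. -/
def IsAvoiding (R : Finset ℕ) (π : Fin n → Fin n) : Prop :=
  IsRPerm R π ∧ ¬ Contains312 R π

/-- Gapless `R`-tuples: `R`-increasing upper tuples such that whenever `a = q_h` is the last index
of a carrel, `b = q_h + 1` is the first index of the next one, and `γ_a > γ_b`, then
`s = γ_a - γ_b + 1` is at most the length of the carrel of `b`, and the first `s` entries of that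
carrel are `γ_a - s + 1, γ_a - s + 2, ..., γ_a`. -/
def IsGapless (R : Finset ℕ) (γ : Fin n → Fin n) : Prop :=
  IsRIncreasing R γ ∧ IsUpper γ ∧
    ∀ a b : Fin n, (b : ℕ) ∈ R → (a : ℕ) + 1 = b → γ b < γ a →
      ∀ s : ℕ, s = (γ a : ℕ) - (γ b : ℕ) + 1 →
        s ≤ carrelEnd R n b - b ∧
        ∀ k < s, ∀ c : Fin n, (c : ℕ) = b + k → (γ c : ℕ) + s = (γ a : ℕ) + 1 + k

/-- The rank `R`-tuple `Ψ_R(π)`: for `i` in the carrel ending at the divider `q`, the entry is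
`rank^{q-i+1} {π_1, ..., π_q}` (the shift of `i` turns `q - i + 1` into `q - i`). -/
def rankTuple [NeZero n] (R : Finset ℕ) (π : Fin n → Fin n) : Fin n → Fin n := fun i =>
  rank ((univ.filter (fun j : Fin n => (j : ℕ) < carrelEnd R n i)).image π) (carrelEnd R n i - i)

/-- Critical indices of an upper tuple, found from the right within each carrel: the last index of a
carrel is critical, and if `x'` is critical, then the next critical index to the left is the largest
`x < x'` in the same carrel with `υ_{x'} - υ_x > x' - x`, if there is one. -/
inductive IsCritical (R : Finset ℕ) (υ : Fin n → Fin n) : Fin n → Prop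
  | last (x : Fin n) (hx : carrelEnd R n x = (x : ℕ) + 1) : IsCritical R υ x
  | next (x x' : Fin n) (hx' : IsCritical R υ x') (hc : SameCarrel R x x') (hlt : x < x')
      (hgap : (x' : ℤ) - x < (υ x' : ℤ) - υ x)
      (hmax : ∀ y : Fin n, x < y → y < x' → ¬ ((x' : ℤ) - y < (υ x' : ℤ) - υ y)) :
      IsCritical R υ x

theorem carrelEnd_last (R : Finset ℕ) (m : ℕ) (h : m + 1 = n) : carrelEnd R n m = m + 1 := by
  unfold carrelEnd
  apply le_antisymm
  · rw [h]
    exact Finset.min'_le _ _ (Finset.mem_insert_self _ _)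
  · refine Finset.le_min' _ _ _ (fun y hy => ?_)
    rcases Finset.mem_insert.mp hy with hy | hy
    · omega
    · have := (Finset.mem_filter.mp hy).2
      omega

open Classical in
theorem exists_critical_ge (R : Finset ℕ) (υ : Fin n → Fin n) (i : Fin n) :
    (univ.filter (fun x : Fin n => i ≤ x ∧ IsCritical R υ x)).Nonempty := by
  have hi := i.isLt
  refine ⟨⟨n - 1, by omega⟩, Finset.mem_filter.mpr ⟨Finset.mem_univ _, ?_, ?_⟩⟩
  · rw [Fin.le_def]
    simp only
    omega
  · exact IsCritical.last _ (carrelEnd_last R (n - 1) (by omega))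

open Classical in
/-- The smallest critical index that is at least `i`. -/
noncomputable def nextCritical (R : Finset ℕ) (υ : Fin n → Fin n) (i : Fin n) : Fin n :=
  (univ.filter (fun x : Fin n => i ≤ x ∧ IsCritical R υ x)).min' (exists_critical_ge R υ i)

/-- The `R`-core `Δ_R(υ)`: it agrees with `υ` at the critical indices, and descends in steps of one
from each critical index `x` to the left: `δ_i = υ_x - (x - i)`. -/
noncomputable def core (R : Finset ℕ) (υ : Fin n → Fin n) : Fin n → Fin n := fun i =>
  ⟨(υ (nextCritical R υ i) : ℕ) - ((nextCritical R υ i : ℕ) - i),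
    lt_of_le_of_lt (Nat.sub_le _ _) (υ (nextCritical R υ i)).isLt⟩

/-- Gapless core `R`-tuples: upper tuples whose `R`-core is gapless. -/
def IsGaplessCore (R : Finset ℕ) (η : Fin n → Fin n) : Prop :=
  IsUpper η ∧ IsGapless R (core R η)

/-- The map `Π_R`.  It keeps the entries of the first carrel.  In a later carrel, which starts
after the divider `q = q_h`, put `s = γ_{q_h} - γ_{q_h+1} + 1` if `γ_{q_h} ≥ γ_{q_h+1}` and `s = 0`
otherwise.  The first `s` entries of the carrel are
`π_i = rank^d ([γ_{q_h}] \ {π_1, ..., π_{q_h}})` with `d = q + s - i + 1` (the shift of `i` turns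
this into `q + s - i`), and the others are `π_i = γ_i`. -/
def permOfGapless [NeZero n] (R : Finset ℕ) (γ : Fin n → Fin n) (i : Fin n) : Fin n :=
  let q : ℕ := carrelStart R i
  have hq : q ≤ i := carrelStart_le R i
  if q = 0 then γ i
  else
    let a : Fin n := ⟨q - 1, by omega⟩
    let b : Fin n := ⟨q, by omega⟩
    let s : ℕ := if γ b ≤ γ a then (γ a : ℕ) - (γ b : ℕ) + 1 else 0
    if (i : ℕ) < q + s then
      rank (Finset.Iic (γ a) \
        (univ : Finset {j : Fin n // (j : ℕ) < q}).image (fun j => permOfGapless R γ j.1))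
        (q + s - i)
    else γ i
termination_by (i : ℕ)
decreasing_by exact lt_of_lt_of_le j.2 hq

end Tuples

section Tableaux

/-- The set `R_λ` of column lengths of the shape that are less than `n`. -/
def dividers (n : ℕ) (μ : YoungDiagram) : Finset ℕ :=
  ((range (μ.rowLen 0)).image μ.colLen).filter (fun q => q < n)

/-- Semistandard tableaux of shape `μ` with values in `[n]`; `T i j` is the value in row `i` and
column `j`. -/
def Tableau (n : ℕ) (μ : YoungDiagram) : Type :=
  {T : SemistandardYoungTableau μ // ∀ i j : ℕ, (i, j) ∈ μ → T i j < n}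

instance (n : ℕ) (μ : YoungDiagram) : Finite (Tableau n μ) := by
  refine Finite.of_injective
    (fun (T : Tableau n μ) (c : {c : ℕ × ℕ // c ∈ μ.cells}) =>
      (⟨T.1 c.1.1 c.1.2, T.2 _ _ c.2⟩ : Fin n)) (fun T U h => ?_)
  apply Subtype.ext
  apply SemistandardYoungTableau.ext
  intro i j
  by_cases hc : (i, j) ∈ μ
  · exact congrArg Fin.val (congrFun h ⟨(i, j), hc⟩)
  · rw [T.1.zeros hc, U.1.zeros hc]

/-- The row bound set `S_λ(β)`.  The first condition is the bound on the latent column, which is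
prepended to the shape, has length `n`, and has the value `i` in each row `i`. -/
def rowBoundSet {n : ℕ} (μ : YoungDiagram) (β : Fin n → Fin n) : Set (Tableau n μ) :=
  {T | (∀ i : Fin n, i ≤ β i) ∧ ∀ (i : Fin n) (j : ℕ), ((i : ℕ), j) ∈ μ → T.1 i j ≤ β i}

/-- The value in row `i` and column `j` of the key `Y_λ(π)`: a column of length `q` holds the set
`{π_1, ..., π_q}` in increasing order from top to bottom. -/
def keyEntry {n : ℕ} (μ : YoungDiagram) (π : Fin n → Fin n) (i j : ℕ) : ℕ :=
  rank ((univ.filter (fun k : Fin n => (k : ℕ) < μ.colLen j)).image (fun k => (π k : ℕ)))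
    (μ.colLen j - i)

/-- The earliest weakly increasing subsequence of a sequence of columns with bottom values `val`,
whose terms must be at least `v`: repeatedly pick the first remaining column whose value is at least
the last value picked. -/
def ewis (val : ℕ → ℕ) : List ℕ → ℕ → List ℕ
  | [], _ => []
  | l :: ls, v => if v ≤ val l then l :: ewis val ls (val l) else ewis val ls v

/-- One pass of the scanning of the filling `T`, with columns `j, j + 1, ..., w - 1`, of which
column `l` has its top `ht l` boxes unmarked: the columns that the scanning path visits, each of
them at its lowest unmarked box. -/
def scanPath (T : ℕ → ℕ → ℕ) (w j : ℕ) (ht : ℕ → ℕ) : List ℕ :=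
  ewis (fun l => T (ht l - 1) l) ((List.range w).filter (fun l => j ≤ l ∧ 0 < ht l)) 0

/-- The number of unmarked boxes of each column after `k` passes of the scanning that starts in
column `j`. -/
def scanHeights (T : ℕ → ℕ → ℕ) (μ : YoungDiagram) (j : ℕ) : ℕ → ℕ → ℕ
  | 0 => μ.colLen
  | k + 1 => fun l =>
      if l ∈ scanPath T (μ.rowLen 0) j (scanHeights T μ j k) then scanHeights T μ j k l - 1
      else scanHeights T μ j k l

/-- The value in row `i` and column `j` of the scanning tableau `S(T)`.  Column `j` is filled from
bottom to top with the last values of the successive scanning paths that start in column `j`; so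
row `i` is filled by the pass that is preceded by `ζ_j - 1 - i` others. -/
def scanEntry (T : ℕ → ℕ → ℕ) (μ : YoungDiagram) (i j : ℕ) : ℕ :=
  let ht := scanHeights T μ j (μ.colLen j - 1 - i)
  ((scanPath T (μ.rowLen 0) j ht).map (fun l => T (ht l - 1) l)).getLastD 0

/-- The set `D_λ(π)` of Demazure tableaux: `S(T) ≤ Y_λ(π)` entrywise. -/
def demazureSet {n : ℕ} (μ : YoungDiagram) (π : Fin n → Fin n) : Set (Tableau n μ) :=
  {T | ∀ i j : ℕ, (i, j) ∈ μ → scanEntry (fun a b => T.1 a b) μ i j ≤ keyEntry μ π i j}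

/-- The content of a tableau: the number of boxes with the value `v`. -/
def content {n : ℕ} {μ : YoungDiagram} (T : Tableau n μ) (v : Fin n) : ℕ :=
  (μ.cells.filter (fun c => T.1 c.1 c.2 = v)).card

/-- A polynomial presented as the generating function of a set of tableaux of some shape.  Two such
presentations are *identical as generating functions* when they are equal, i.e. when their
shapes and their sets of tableaux coincide. -/
structure TableauSum (n : ℕ) where
  shape : YoungDiagram
  tableaux : Set (Tableau n shape)

/-- The polynomial in `x_1, ..., x_n`: the sum of the content monomials of the tableaux. -/
noncomputable def TableauSum.poly {n : ℕ} (F : TableauSum n) : MvPolynomial (Fin n) ℤ :=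
  ∑ T ∈ (Set.toFinite F.tableaux).toFinset, ∏ v : Fin n, MvPolynomial.X v ^ content T v

/-- `F ≡ G`: identical as generating functions. -/
def Identical {n : ℕ} (F G : TableauSum n) : Prop := F = G

/-- The row bound sum `s_λ(β; x)`; it is a flag Schur polynomial if `β` is an upper flag, and a
gapless core Schur polynomial if `β` is a gapless core tuple. -/
def rowBoundSum {n : ℕ} (μ : YoungDiagram) (β : Fin n → Fin n) : TableauSum n :=
  ⟨μ, rowBoundSet μ β⟩

/-- The Demazure polynomial `d_λ(π; x)`. -/
def demazureSum {n : ℕ} (μ : YoungDiagram) (π : Fin n → Fin n) : TableauSum n :=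
  ⟨μ, demazureSet μ π⟩

end Tableaux

end FlagDemazure

open FlagDemazure

namespace FlagDemazure

open Finset

/-! Everything is translated into counting: `v ≤ rank Q d` holds exactly when at least `d` elements
of `Q` are `≥ v` (`le_rank_iff`). Bounds by keys and by rank tuples thus become lower bounds for
`countGe` on the sets `prefixSet π q`, and 312-avoidance becomes the statement `PairAvoids` about
two such nested sets.

The central identity is `IsAvoiding.demazureSet_eq`: for an avoiding `π`, the Demazure set is the
row bound set of the rank tuple. One inclusion needs only `T ≤ S(T)`: the last column that meets row
`i` ends where the carrel of `i` ends, so its key entry in row `i` is the rank tuple at `i`, and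
rows increase weakly. In the other direction, avoidance turns row bounds into key bounds on every
column of `T` and then carries these bounds through the scanning. Both steps rest on
`PairAvoids.le_countGe`: either all elements added to the smaller set are large, and counting
suffices, or some added element is small, and avoidance fills a whole interval.

On the side of tuples, column strictness makes a bound in row `j` also a bound in each row above it
in the same carrel, one less per row. Hence a row bound set depends only on the core, and a gapless
tuple may be replaced by its running maximum, which is a flag. The core of a flag is gapless, and
`permOfGapless` sends gapless tuples to avoiding permutations whose rank tuples are the given
tuples.

Uniqueness comes from keys. The key of `π` lies in the Demazure set of `π` and lies below its own
scanning tableau, so equal Demazure sets have equal keys, and the keys determine `π`. Since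
`rankTuple` undoes `permOfGapless`, the core is determined as well. -/

/-! ### Counting from above -/

section Count

variable {α : Type} [LinearOrder α]

/-- The number of elements of `B` that are at least `v`. -/
def countGe (B : Finset α) (v : α) : ℕ := (B.filter (fun y => v ≤ y)).card

theorem countGe_anti (B : Finset α) {v w : α} (h : v ≤ w) : countGe B w ≤ countGe B v :=
  card_le_card (fun x hx => by
    rw [mem_filter] at hx ⊢
    exact ⟨hx.1, h.trans hx.2⟩)

theorem countGe_mono {B' B : Finset α} (h : B' ⊆ B) (v : α) : countGe B' v ≤ countGe B v :=
  card_le_card (filter_subset_filter _ h)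

theorem countGe_le_add {B' B : Finset α} (h : B' ⊆ B) (v : α) :
    countGe B v + B'.card ≤ countGe B' v + B.card := by
  have h1 : B.filter (fun y => v ≤ y) ⊆ B'.filter (fun y => v ≤ y) ∪ (B \ B') := by
    intro x hx
    rw [mem_filter] at hx
    by_cases hx' : x ∈ B'
    · exact mem_union_left _ (mem_filter.mpr ⟨hx', hx.2⟩)
    · exact mem_union_right _ (mem_sdiff.mpr ⟨hx.1, hx'⟩)
  have h2 := (card_le_card h1).trans (card_union_le _ _)
  have h3 := card_sdiff_add_card_eq_card h
  unfold countGe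
  omega

variable [Inhabited α]

/-- This replaces the sorted list in the definition of `rank` by membership and a count. The range
of `d` keeps the default value of `getD` out of play. -/
theorem rank_mem_and_countGe {Q : Finset α} {d : ℕ} (hd : 1 ≤ d) (hd' : d ≤ Q.card) :
    rank Q d ∈ Q ∧ countGe Q (rank Q d) = d := by
  set L := Q.sort (fun a b => b ≤ a) with hL
  have hlen : L.length = Q.card := length_sort _
  have hget : ∀ k, (hk : k < Q.card) → L.getD k default = L[k]'(by omega) := by
    intro k hk
    exact List.getD_eq_getElem _ _ (by omega)
  have hmem : ∀ k, k < Q.card → L.getD k default ∈ Q := by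
    intro k hk
    rw [hget k hk, ← mem_sort (fun a b => b ≤ a)]
    exact List.getElem_mem _
  have hnd : L.Nodup := sort_nodup _ _
  have hle : ∀ k l, k ≤ l → l < Q.card → L.getD l default ≤ L.getD k default := by
    intro k l hkl hl
    rw [hget k (by omega), hget l hl]
    rcases hkl.eq_or_lt with rfl | hkl
    · exact le_rfl
    · exact List.pairwise_iff_getElem.mp (pairwise_sort Q (fun a b => b ≤ a)) k l _ _ hkl
  have hinj : ∀ k l, k < Q.card → l < Q.card → L.getD k default = L.getD l default → k = l := by
    intro k l hk hl h
    rw [hget k hk, hget l hl] at h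
    exact (hnd.getElem_inj_iff).mp h
  refine ⟨hmem _ (by omega), ?_⟩
  have hset : Q.filter (fun y => rank Q d ≤ y) = (range d).image (fun k => L.getD k default) := by
    ext y
    rw [mem_filter, mem_image]
    constructor
    · rintro ⟨hy, hy'⟩
      obtain ⟨k, hk, rfl⟩ := List.mem_iff_getElem.mp ((mem_sort (fun a b : α => b ≤ a)).mpr hy)
      change k < L.length at hk
      change L.getD (d - 1) default ≤ L[k] at hy'
      have hk' : k < Q.card := by omega
      refine ⟨k, mem_range.mpr ?_, hget k hk'⟩
      by_contra hkd
      rw [← hget k hk'] at hy'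
      have := hinj k (d - 1) hk' (by omega) (le_antisymm (hle _ _ (by omega) hk') hy')
      omega
    · rintro ⟨k, hk, rfl⟩
      rw [mem_range] at hk
      exact ⟨hmem k (by omega), hle k (d - 1) (by omega) (by omega)⟩
  unfold countGe
  rw [hset, card_image_of_injOn, card_range]
  intro k hk l hl h
  simp only [coe_range, Set.mem_Iio] at hk hl
  exact hinj k l (by omega) (by omega) h

theorem le_rank_iff {Q : Finset α} {d : ℕ} (hd : 1 ≤ d) (hd' : d ≤ Q.card) {v : α} :
    v ≤ rank Q d ↔ d ≤ countGe Q v := by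
  obtain ⟨hm, hc⟩ := rank_mem_and_countGe hd hd'
  constructor
  · intro h
    exact hc.ge.trans (countGe_anti Q h)
  · intro h
    by_contra hv
    rw [not_le] at hv
    have : Q.filter (fun y => v ≤ y) ⊂ Q.filter (fun y => rank Q d ≤ y) := by
      refine (Finset.ssubset_iff_of_subset ?_).mpr
        ⟨rank Q d, mem_filter.mpr ⟨hm, le_rfl⟩, fun h' => ?_⟩
      · intro x hx
        rw [mem_filter] at hx ⊢
        exact ⟨hx.1, hv.le.trans hx.2⟩
      · exact absurd (mem_filter.mp h').2 (not_le.mpr hv)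
    have := card_lt_card this
    unfold countGe at hc h
    omega

theorem rank_eq_of_countGe {Q : Finset α} {d : ℕ} {y : α} (hy : y ∈ Q) (h : countGe Q y = d) :
    rank Q d = y := by
  have hd : 1 ≤ d := by
    rw [← h]
    exact card_pos.mpr ⟨y, mem_filter.mpr ⟨hy, le_rfl⟩⟩
  have hd' : d ≤ Q.card := h ▸ card_le_card (filter_subset _ _)
  obtain ⟨hm, hc⟩ := rank_mem_and_countGe hd hd'
  have h1 : y ≤ rank Q d := (le_rank_iff hd hd').mpr h.ge
  refine le_antisymm ?_ h1
  have hs : Q.filter (fun z => rank Q d ≤ z) = Q.filter (fun z => y ≤ z) := by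
    refine eq_of_subset_of_card_le (fun x hx => ?_) ?_
    · rw [mem_filter] at hx ⊢
      exact ⟨hx.1, h1.trans hx.2⟩
    · exact (h.trans hc.symm).le
  exact (mem_filter.mp (hs ▸ mem_filter.mpr ⟨hy, le_rfl⟩ : y ∈ Q.filter (fun z => rank Q d ≤ z))).2

theorem rank_lt_rank {Q : Finset α} {d d' : ℕ} (hd : 1 ≤ d) (hdd' : d < d') (hd' : d' ≤ Q.card) :
    rank Q d' < rank Q d := by
  rw [← not_le, le_rank_iff (by omega) hd', (rank_mem_and_countGe hd (by omega)).2]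
  omega

theorem eq_of_rank_eq {Q Q' : Finset α} (hc : Q.card = Q'.card)
    (h : ∀ d, 1 ≤ d → d ≤ Q.card → rank Q d = rank Q' d) : Q = Q' := by
  refine eq_of_subset_of_card_le (fun y hy => ?_) hc.ge
  have h1 : 1 ≤ countGe Q y := card_pos.mpr ⟨y, mem_filter.mpr ⟨hy, le_rfl⟩⟩
  have h2 : countGe Q y ≤ Q.card := card_le_card (filter_subset _ _)
  rw [← rank_eq_of_countGe hy rfl, h _ h1 h2]
  exact (rank_mem_and_countGe h1 (hc ▸ h2)).1

end Count

theorem countGe_zero (B : Finset ℕ) : countGe B 0 = B.card := by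
  simp [countGe]

theorem countGe_image_val {n : ℕ} (Q : Finset (Fin n)) (v : Fin n) :
    countGe (Q.image Fin.val) (v : ℕ) = countGe Q v := by
  unfold countGe
  rw [filter_image, card_image_of_injective _ Fin.val_injective]
  rfl

theorem val_rank {n : ℕ} [NeZero n] (Q : Finset (Fin n)) {d : ℕ} (hd : 1 ≤ d) (hd' : d ≤ Q.card) :
    ((rank Q d : Fin n) : ℕ) = rank (Q.image Fin.val) d := by
  obtain ⟨hm, hc⟩ := rank_mem_and_countGe hd hd'
  exact (rank_eq_of_countGe (mem_image_of_mem _ hm) ((countGe_image_val Q _).trans hc)).symm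

/-! ### Avoidance for nested sets -/

/-- The pattern 312 does not occur with its largest value in `B'`, its smallest value in `B \ B'`,
and its middle value outside `B`. -/
def PairAvoids (B' B : Finset ℕ) : Prop :=
  ∀ a ∈ B', ∀ b ∈ B, b ∉ B' → ∀ x, b < x → x < a → x ∈ B

theorem exists_mem_of_le_countGe {B : Finset ℕ} {v s : ℕ} (hs : 1 ≤ s) (h : s ≤ countGe B v) :
    ∃ a ∈ B, v + s ≤ a + 1 := by
  by_contra! hcon
  have : B.filter (fun y => v ≤ y) ⊆ Ico v (v + s - 1) := by
    intro x hx
    rw [mem_filter] at hx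
    have := hcon x hx.1
    rw [mem_Ico]
    omega
  have := card_le_card this
  rw [Nat.card_Ico] at this
  unfold countGe at h
  omega

theorem countGe_eq_add_of_Ico_subset {B : Finset ℕ} {v d : ℕ} (h : Ico v (v + d) ⊆ B) :
    countGe B v = d + countGe B (v + d) := by
  have h1 : B.filter (fun y => v ≤ y) = Ico v (v + d) ∪ B.filter (fun y => v + d ≤ y) := by
    ext x
    rw [mem_union, mem_filter, mem_filter, mem_Ico]
    constructor
    · rintro ⟨h1, h2⟩
      by_cases hx : x < v + d
      · exact Or.inl ⟨h2, hx⟩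
      · exact Or.inr ⟨h1, by omega⟩
    · rintro (hx | hx)
      · exact ⟨h (mem_Ico.mpr hx), hx.1⟩
      · exact ⟨hx.1, by omega⟩
  unfold countGe
  rw [h1, card_union_of_disjoint, Nat.card_Ico]
  · omega
  · refine disjoint_left.mpr (fun x hx hx' => ?_)
    rw [mem_Ico] at hx
    rw [mem_filter] at hx'
    omega

/-- If all of `B \ B'` is `≥ v`, its elements add at least `t` to the `s` counted in `B'`. Otherwise
some added `b` is `< v`, while `B'` has an element `≥ v + s - 1`. Avoidance puts everything between
them into `B`, so `[v, v + d) ⊆ B` and the count at `v` exceeds that at `v + d` by exactly `d`. -/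
theorem PairAvoids.le_countGe {B' B : Finset ℕ} (hP : PairAvoids B' B) (hsub : B' ⊆ B)
    {v s t d : ℕ} (hs : s ≤ countGe B' v) (ht : t + B'.card ≤ B.card) (hd : d ≤ s)
    (hst : s + t ≤ countGe B (v + d) + d) : s + t ≤ countGe B v := by
  by_cases h : ∀ b ∈ B, b ∉ B' → v ≤ b
  · have h1 : B'.filter (fun y => v ≤ y) ∪ (B \ B') ⊆ B.filter (fun y => v ≤ y) := by
      intro x hx
      rw [mem_union, mem_filter, mem_sdiff] at hx
      rw [mem_filter]
      rcases hx with hx | hx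
      · exact ⟨hsub hx.1, hx.2⟩
      · exact ⟨hx.1, h x hx.1 hx.2⟩
    have h2 := card_le_card h1
    rw [card_union_of_disjoint] at h2
    · have h3 := card_sdiff_add_card_eq_card hsub
      unfold countGe at hs ⊢
      omega
    · refine disjoint_left.mpr (fun x hx hx' => ?_)
      exact (mem_sdiff.mp hx').2 (mem_filter.mp hx).1
  · push Not at h
    obtain ⟨b, hb, hb', hbv⟩ := h
    have : Ico v (v + d) ⊆ B := by
      intro x hx
      rw [mem_Ico] at hx
      obtain ⟨a, ha, hav⟩ := exists_mem_of_le_countGe (by omega) hs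
      rcases (show x ≤ a by omega).eq_or_lt with rfl | hxa
      · exact hsub ha
      · exact hP a ha b hb hb' x (by omega) hxa
    rw [countGe_eq_add_of_Ico_subset this]
    omega

/-! ### Carrels -/

section Carrels

variable {R : Finset ℕ} {n i j q : ℕ}

theorem lt_carrelEnd (h : i < n) : i < carrelEnd R n i := by
  unfold carrelEnd
  rw [lt_min'_iff]
  intro y hy
  rcases mem_insert.mp hy with rfl | hy
  · exact h
  · exact (mem_filter.mp hy).2

theorem carrelEnd_le (R : Finset ℕ) (n i : ℕ) : carrelEnd R n i ≤ n :=
  min'_le _ _ (mem_insert_self _ _)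

theorem carrelEnd_mem (R : Finset ℕ) (n i : ℕ) : carrelEnd R n i ∈ R ∨ carrelEnd R n i = n := by
  rcases mem_insert.mp (min'_mem _ (insert_nonempty n (R.filter (fun q => i < q)))) with h | h
  · exact Or.inr h
  · exact Or.inl (mem_filter.mp h).1

theorem carrelEnd_le_of_mem (hq : q ∈ R) (h : i < q) : carrelEnd R n i ≤ q :=
  min'_le _ _ (mem_insert_of_mem (mem_filter.mpr ⟨hq, h⟩))

theorem carrelEnd_eq (hij : i ≤ j) (h : j < carrelEnd R n i) :
    carrelEnd R n j = carrelEnd R n i := by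
  apply le_antisymm
  · rcases carrelEnd_mem R n i with h' | h'
    · exact carrelEnd_le_of_mem h' h
    · exact (carrelEnd_le R n j).trans h'.ge
  · rcases carrelEnd_mem R n j with h' | h'
    · exact carrelEnd_le_of_mem h' (lt_of_le_of_lt hij
        (lt_carrelEnd (h.trans_le (carrelEnd_le R n i))))
    · exact (carrelEnd_le R n i).trans h'.ge

theorem le_carrelStart (hq : q ∈ R) (h : q ≤ i) : q ≤ carrelStart R i :=
  Finset.le_sup (f := id) (mem_filter.mpr ⟨hq, h⟩)

theorem carrelStart_mem (R : Finset ℕ) (i : ℕ) (h : carrelStart R i ≠ 0) : carrelStart R i ∈ R := by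
  have hne : (R.filter (fun q => q ≤ i)).Nonempty := by
    by_contra hne
    rw [not_nonempty_iff_eq_empty] at hne
    apply h
    unfold carrelStart
    rw [hne]
    rfl
  obtain ⟨q, hq, hq'⟩ := exists_mem_eq_sup _ hne id
  unfold carrelStart
  rw [hq']
  exact (mem_filter.mp hq).1

/-- Carrels are handled below mostly through their right ends, where membership is a single
inequality. -/
theorem sameCarrel_iff (hij : i ≤ j) (hj : j < n) : SameCarrel R i j ↔ j < carrelEnd R n i := by
  constructor
  · intro h
    by_contra hcon
    rw [not_lt] at hcon
    rcases carrelEnd_mem R n i with h' | h'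
    · have h1 := le_carrelStart h' hcon
      have h2 := lt_carrelEnd (R := R) (lt_of_le_of_lt hij hj)
      have h3 := carrelStart_le R i
      unfold SameCarrel at h
      omega
    · omega
  · intro h
    unfold SameCarrel carrelStart
    congr 1
    ext q
    rw [mem_filter, mem_filter]
    constructor
    · rintro ⟨hq, hq'⟩
      exact ⟨hq, by omega⟩
    · rintro ⟨hq, hq'⟩
      refine ⟨hq, ?_⟩
      by_contra hcon
      have := carrelEnd_le_of_mem (n := n) hq (not_le.mp hcon)
      omega

theorem carrelEnd_carrelStart (h : i < n) :
    carrelEnd R n (carrelStart R i) = carrelEnd R n i ∧ i < carrelEnd R n (carrelStart R i) := by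
  have h1 : i < carrelEnd R n (carrelStart R i) := by
    rcases carrelEnd_mem R n (carrelStart R i) with h' | h'
    · by_contra hcon
      have h2 := le_carrelStart h' (not_lt.mp hcon)
      have h3 := lt_carrelEnd (R := R) (lt_of_le_of_lt (carrelStart_le R i) h)
      omega
    · omega
  exact ⟨(carrelEnd_eq (carrelStart_le R i) h1).symm, h1⟩

theorem carrelStart_eq (hq : q ∈ R) (h : q ≤ i) (h' : i < carrelEnd R n q) :
    carrelStart R i = q := by
  refine le_antisymm ?_ (le_carrelStart hq h)
  by_contra hcon
  have h1 := carrelStart_mem R i (by omega)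
  have h2 := carrelEnd_le_of_mem (n := n) h1 (not_le.mp hcon)
  have := carrelStart_le R i
  omega

end Carrels

/-! ### Sets of first entries -/

section Prefix

variable {n : ℕ}

/-- The set `{π_1, ..., π_q}`. -/
def prefixSet (π : Fin n → Fin n) (q : ℕ) : Finset ℕ :=
  (univ.filter (fun k : Fin n => (k : ℕ) < q)).image (fun k => (π k : ℕ))

theorem mem_prefixSet {π : Fin n → Fin n} {q y : ℕ} :
    y ∈ prefixSet π q ↔ ∃ k : Fin n, (k : ℕ) < q ∧ (π k : ℕ) = y := by
  simp [prefixSet]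

theorem prefixSet_mono (π : Fin n → Fin n) {q q' : ℕ} (h : q ≤ q') :
    prefixSet π q ⊆ prefixSet π q' := by
  intro y hy
  rw [mem_prefixSet] at hy ⊢
  obtain ⟨k, hk, hy⟩ := hy
  exact ⟨k, by omega, hy⟩

theorem card_filter_lt {q : ℕ} (h : q ≤ n) :
    (univ.filter (fun k : Fin n => (k : ℕ) < q)).card = q := by
  have : (univ.filter (fun k : Fin n => (k : ℕ) < q)).image Fin.val = range q := by
    ext y
    simp only [mem_image, mem_filter, mem_univ, true_and, mem_range]
    constructor
    · rintro ⟨k, hk, rfl⟩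
      exact hk
    · intro hy
      exact ⟨⟨y, by omega⟩, hy, rfl⟩
  rw [← card_image_of_injective _ Fin.val_injective, this, card_range]

theorem card_prefixSet_of_injOn {π : Fin n → Fin n} {q : ℕ} (hq : q ≤ n)
    (h : ∀ i j : Fin n, (i : ℕ) < q → (j : ℕ) < q → π i = π j → i = j) :
    (prefixSet π q).card = q := by
  unfold prefixSet
  rw [card_image_of_injOn, card_filter_lt hq]
  intro i hi j hj hij
  simp only [coe_filter, mem_univ, true_and, Set.mem_ofPred_eq] at hi hj
  exact h i j hi hj (Fin.ext hij)

theorem card_prefixSet {π : Fin n → Fin n} (hπ : Function.Injective π) {q : ℕ} (hq : q ≤ n) :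
    (prefixSet π q).card = q :=
  card_prefixSet_of_injOn hq (fun _ _ _ _ h => hπ h)

theorem notMem_prefixSet {π : Fin n → Fin n} (hπ : Function.Injective π) {q : ℕ} {k : Fin n}
    (h : q ≤ k) : (π k : ℕ) ∉ prefixSet π q := by
  rw [mem_prefixSet]
  rintro ⟨l, hl, hlk⟩
  have := hπ (Fin.ext hlk)
  subst this
  omega

theorem val_rankTuple [NeZero n] (R : Finset ℕ) {π : Fin n → Fin n} (hπ : Function.Injective π)
    (i : Fin n) : (rankTuple R π i : ℕ)
      = rank (prefixSet π (carrelEnd R n i)) (carrelEnd R n i - i) := by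
  have h1 := lt_carrelEnd (R := R) i.isLt
  have h2 := carrelEnd_le R n i
  unfold rankTuple
  rw [val_rank]
  · congr 1
    unfold prefixSet
    rw [image_image]
    rfl
  · omega
  · rw [card_image_of_injective _ hπ, card_filter_lt h2]
    omega

theorem le_rankTuple_iff [NeZero n] {R : Finset ℕ} {π : Fin n → Fin n}
    (hπ : Function.Injective π) {i : Fin n} {v : ℕ} : v ≤ rankTuple R π i ↔
      carrelEnd R n i - i ≤ countGe (prefixSet π (carrelEnd R n i)) v := by
  have h1 := lt_carrelEnd (R := R) i.isLt
  rw [val_rankTuple R hπ, le_rank_iff (by omega)]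
  rw [card_prefixSet hπ (carrelEnd_le R n i)]
  omega

/-- The value `n` is allowed for `q` and `q'` because columns may have length `n`. In an actual 312
pattern the indices `b ≥ q` and `c ≥ q'` exclude it. -/
theorem pairAvoids_prefixSet {R : Finset ℕ} {π : Fin n → Fin n} (hπ : Function.Injective π)
    (h : ¬ Contains312 R π) {q q' : ℕ} (hq : q ∈ R ∨ q = n) (hq' : q' ∈ R ∨ q' = n) :
    PairAvoids (prefixSet π q) (prefixSet π q') := by
  intro a ha b hb hb' x hbx hxa
  by_contra hx
  obtain ⟨a, haq, rfl⟩ := mem_prefixSet.mp ha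
  obtain ⟨b, hbq, rfl⟩ := mem_prefixSet.mp hb
  obtain ⟨c, hc⟩ := (Finite.injective_iff_surjective.mp hπ) ⟨x, hxa.trans (π a).isLt⟩
  have hcx : (π c : ℕ) = x := by rw [hc]
  have hqb : q ≤ b := by
    by_contra hcon
    exact hb' (mem_prefixSet.mpr ⟨b, by omega, rfl⟩)
  have hqc : q' ≤ c := by
    by_contra hcon
    exact hx (mem_prefixSet.mpr ⟨c, by omega, hcx⟩)
  refine h ⟨q, hq.resolve_right (by omega), q', hq'.resolve_right (by omega), a, b, c, haq, hqb,
    hbq, hqc, ?_, ?_⟩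
  · rw [Fin.lt_def, hcx]
    exact hbx
  · rw [Fin.lt_def, hcx]
    exact hxa

/-- An `R`-permutation is determined by its sets of first entries. -/
theorem IsRPerm.eq_of_prefixSet_eq {R : Finset ℕ} {π π' : Fin n → Fin n} (hπ : IsRPerm R π)
    (hπ' : IsRPerm R π') (h : ∀ q, q ∈ R ∨ q = n → prefixSet π q = prefixSet π' q) : π = π' := by
  -- If `π i < π' i` at the first disagreement, then `π i` must be some `π' k` in the same prefix.
  -- Injectivity excludes `k < i`, and the increase of `π'` on the carrel excludes `k > i`.
  have key : ∀ {π π' : Fin n → Fin n}, IsRPerm R π → IsRPerm R π' →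
      (∀ q, q ∈ R ∨ q = n → prefixSet π q = prefixSet π' q) → ∀ i : Fin n,
      (∀ k < i, π k = π' k) → π' i ≤ π i := by
    intro π π' hπ hπ' h i ih
    by_contra hlt
    have h1 := lt_carrelEnd (R := R) i.isLt
    have hmem : (π i : ℕ) ∈ prefixSet π (carrelEnd R n i) := mem_prefixSet.mpr ⟨i, h1, rfl⟩
    rw [h _ (carrelEnd_mem R n i), mem_prefixSet] at hmem
    obtain ⟨k, hk, hki⟩ := hmem
    rcases lt_trichotomy k i with hki' | rfl | hki'
    · rw [← ih k hki'] at hki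
      exact hki'.ne (hπ.1 (Fin.ext hki))
    · omega
    · have := hπ'.2 i k hki' ((sameCarrel_iff hki'.le k.isLt).mpr hk)
      rw [Fin.lt_def] at this
      omega
  funext i
  induction i using Fin.strong_induction_on with
  | _ i ih =>
    exact le_antisymm (key hπ' hπ (fun q hq => (h q hq).symm) i (fun k hk => (ih k hk).symm))
      (key hπ hπ' h i ih)

end Prefix

/-! ### Scanning -/

section Ewis

variable (val : ℕ → ℕ)

/-- The last value of an earliest weakly increasing subsequence whose terms are at least `v`, with
`v` for the empty one. -/
def runValue : List ℕ → ℕ → ℕ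
  | [], v => v
  | l :: ls, v => if v ≤ val l then runValue ls (val l) else runValue ls v

theorem runValue_append (ls ls' : List ℕ) (v : ℕ) :
    runValue val (ls ++ ls') v = runValue val ls' (runValue val ls v) := by
  induction ls generalizing v with
  | nil => rfl
  | cons l ls ih =>
    simp only [List.cons_append, runValue]
    split_ifs <;> exact ih _

theorem ewis_append (ls ls' : List ℕ) (v : ℕ) :
    ewis val (ls ++ ls') v = ewis val ls v ++ ewis val ls' (runValue val ls v) := by
  induction ls generalizing v with
  | nil => rfl
  | cons l ls ih =>
    simp only [List.cons_append, runValue, ewis]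
    split_ifs
    · rw [ih, List.cons_append]
    · exact ih _

theorem getLastD_map_ewis (ls : List ℕ) (v : ℕ) :
    ((ewis val ls v).map val).getLastD v = runValue val ls v := by
  induction ls generalizing v with
  | nil => rfl
  | cons l ls ih =>
    simp only [runValue, ewis]
    split_ifs
    · rw [List.map_cons, List.getLastD_cons]
      exact ih _
    · exact ih _

theorem mem_of_mem_ewis {ls : List ℕ} {v m : ℕ} (h : m ∈ ewis val ls v) : m ∈ ls := by
  induction ls generalizing v with
  | nil => exact h
  | cons l ls ih =>
    simp only [ewis] at h
    split_ifs at h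
    · rcases List.mem_cons.mp h with rfl | h
      · exact List.mem_cons_self
      · exact List.mem_cons_of_mem _ (ih h)
    · exact List.mem_cons_of_mem _ (ih h)

/-- Whether a path visits column `m` depends only on the columns to its left. This makes induction
on columns possible. -/
theorem mem_ewis_filter_range (p : ℕ → Prop) [DecidablePred p] (w m : ℕ) :
    m ∈ ewis val ((List.range w).filter (fun l => p l)) 0 ↔
      m < w ∧ p m ∧ runValue val ((List.range m).filter (fun l => p l)) 0 ≤ val m := by
  induction w with
  | zero => simp [ewis]
  | succ w ih =>
    rw [List.range_succ, List.filter_append, ewis_append, List.mem_append, ih]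
    constructor
    · rintro (⟨h1, h2⟩ | h)
      · exact ⟨by omega, h2⟩
      · have hm := mem_of_mem_ewis val h
        by_cases hp : p w
        · simp only [List.filter_cons, hp, decide_true, if_true, List.filter_nil,
            List.mem_singleton] at hm
          subst hm
          refine ⟨by omega, hp, ?_⟩
          simp only [List.filter_cons, hp, decide_true, if_true, List.filter_nil, ewis] at h
          by_contra hcon
          rw [if_neg hcon] at h
          exact absurd h List.not_mem_nil
        · simp [hp] at hm
    · rintro ⟨h1, hp, h2⟩
      rcases (show m ≤ w by omega).eq_or_lt with rfl | hlt
      · right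
        simp [hp, ewis, h2]
      · exact Or.inl ⟨hlt, hp, h2⟩

end Ewis

section Scan

variable (T : ℕ → ℕ → ℕ) (μ : YoungDiagram) (j : ℕ)

/-- The last value that pass `k` of the scanning from column `j` picks left of column `m`. -/
def passValue (k m : ℕ) : ℕ :=
  runValue (fun l => T (scanHeights T μ j k l - 1) l)
    ((List.range m).filter (fun l => j ≤ l ∧ 0 < scanHeights T μ j k l)) 0

/-- Pass `k` of the scanning from column `j` visits column `m`. -/
def Visits (k m : ℕ) : Prop :=
  j ≤ m ∧ 0 < scanHeights T μ j k m ∧ passValue T μ j k m ≤ T (scanHeights T μ j k m - 1) m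

theorem passValue_succ_of_visits {k m : ℕ} (h : Visits T μ j k m) :
    passValue T μ j k (m + 1) = T (scanHeights T μ j k m - 1) m := by
  have h' := h.2.2
  unfold passValue at h' ⊢
  rw [List.range_succ, List.filter_append, runValue_append]
  have h1 : j ≤ m ∧ 0 < scanHeights T μ j k m := ⟨h.1, h.2.1⟩
  simp only [List.filter_cons, h1, and_self, decide_true, if_true, List.filter_nil, runValue]
  rw [if_pos h']

theorem passValue_succ_of_not_visits {k m : ℕ} (h : ¬ Visits T μ j k m) :
    passValue T μ j k (m + 1) = passValue T μ j k m := by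
  unfold Visits passValue at h
  unfold passValue
  rw [List.range_succ, List.filter_append, runValue_append]
  by_cases h1 : j ≤ m ∧ 0 < scanHeights T μ j k m
  · have h2 := fun h3 => h ⟨h1.1, h1.2, h3⟩
    simp only [List.filter_cons, h1, and_self, decide_true, if_true, List.filter_nil, runValue]
    rw [if_neg h2]
  · simp only [List.filter_cons, h1, decide_false, Bool.false_eq_true, if_false, List.filter_nil,
      runValue]

theorem passValue_self (k : ℕ) : passValue T μ j k j = 0 := by
  unfold passValue
  rw [List.filter_eq_nil_iff.mpr]
  · rfl
  · intro l hl
    rw [List.mem_range] at hl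
    simp only [decide_eq_true_eq, not_and]
    omega

theorem scanHeights_succ_of_visits {k m : ℕ} (hm : m < μ.rowLen 0) (h : Visits T μ j k m) :
    scanHeights T μ j (k + 1) m = scanHeights T μ j k m - 1 := by
  have : m ∈ scanPath T (μ.rowLen 0) j (scanHeights T μ j k) :=
    (mem_ewis_filter_range _ (fun l => j ≤ l ∧ 0 < scanHeights T μ j k l) _ _).mpr
      ⟨hm, ⟨h.1, h.2.1⟩, h.2.2⟩
  simp only [scanHeights, this, if_true]

theorem scanHeights_succ_of_not_visits {k m : ℕ} (h : ¬ Visits T μ j k m) :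
    scanHeights T μ j (k + 1) m = scanHeights T μ j k m := by
  have : m ∉ scanPath T (μ.rowLen 0) j (scanHeights T μ j k) := by
    intro hmem
    have h' := (mem_ewis_filter_range _ (fun l => j ≤ l ∧ 0 < scanHeights T μ j k l) _ _).mp hmem
    exact h ⟨h'.2.1.1, h'.2.1.2, h'.2.2⟩
  simp only [scanHeights, this, if_false]

theorem scanEntry_eq (i : ℕ) :
    scanEntry T μ i j = passValue T μ j (μ.colLen j - 1 - i) (μ.rowLen 0) :=
  getLastD_map_ewis _ _ _

theorem passValue_le_succ (k m : ℕ) : passValue T μ j k m ≤ passValue T μ j k (m + 1) := by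
  by_cases h : Visits T μ j k m
  · rw [passValue_succ_of_visits T μ j h]
    exact h.2.2
  · rw [passValue_succ_of_not_visits T μ j h]

theorem passValue_mono (k : ℕ) : Monotone (passValue T μ j k) :=
  monotone_nat_of_le_succ (passValue_le_succ T μ j k)

theorem scanHeights_succ_le (k m : ℕ) :
    scanHeights T μ j (k + 1) m ≤ scanHeights T μ j k m := by
  simp only [scanHeights]
  split_ifs <;> omega

theorem le_scanHeights_add (k m : ℕ) : μ.colLen m ≤ scanHeights T μ j k m + k := by
  induction k with
  | zero => exact le_rfl
  | succ k ih =>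
    simp only [scanHeights]
    split_ifs <;> omega

theorem scanHeights_le (k m : ℕ) : scanHeights T μ j k m ≤ μ.colLen m := by
  induction k with
  | zero => exact le_rfl
  | succ k ih => exact (scanHeights_succ_le T μ j k m).trans ih

/-- Each pass starts with the value `0`, so it always takes the bottom box of column `j`. -/
theorem scanHeights_self (hj : j < μ.rowLen 0) {k : ℕ} (hk : k ≤ μ.colLen j) :
    scanHeights T μ j k j = μ.colLen j - k := by
  induction k with
  | zero => rfl
  | succ k ih =>
    have ih := ih (by omega)
    rw [scanHeights_succ_of_visits T μ j hj ⟨le_rfl, by omega, by rw [passValue_self]; omega⟩, ih]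
    omega

theorem passValue_self_succ (hj : j < μ.rowLen 0) {k : ℕ} (hk : k < μ.colLen j) :
    passValue T μ j k (j + 1) = T (μ.colLen j - 1 - k) j := by
  have hH := scanHeights_self T μ j hj hk.le
  rw [passValue_succ_of_visits T μ j ⟨le_rfl, by omega, by rw [passValue_self]; omega⟩, hH]
  congr 1
  omega

end Scan

/-! ### Scanning of semistandard tableaux -/

section Tableau

variable {μ : YoungDiagram} (T : SemistandardYoungTableau μ)

theorem lt_rowLen_zero {i j : ℕ} (h : (i, j) ∈ μ) : j < μ.rowLen 0 :=
  YoungDiagram.mem_iff_lt_rowLen.mp (μ.up_left_mem (Nat.zero_le i) le_rfl h)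

theorem entry_add_le {i k l : ℕ} (hik : i ≤ k) (h : (k, l) ∈ μ) : T i l + (k - i) ≤ T k l := by
  induction k with
  | zero =>
    obtain rfl : i = 0 := by omega
    simp
  | succ k ih =>
    rcases hik.eq_or_lt with rfl | hlt
    · simp
    · have h1 := ih (by omega) (μ.up_left_mem (show k ≤ k + 1 by omega) le_rfl h)
      have h2 := T.col_strict (show k < k + 1 by omega) h
      omega

/-- A semistandard tableau lies below its scanning tableau. -/
theorem le_scanEntry {i j : ℕ} (h : (i, j) ∈ μ) : T i j ≤ scanEntry T μ i j := by
  have hj := lt_rowLen_zero h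
  have hi := YoungDiagram.mem_iff_lt_colLen.mp h
  rw [scanEntry_eq]
  refine le_trans (le_of_eq ?_) (passValue_mono T μ j _ (show j + 1 ≤ μ.rowLen 0 from hj))
  rw [passValue_self_succ T μ j hj (by omega),
    show μ.colLen j - 1 - (μ.colLen j - 1 - i) = i by omega]

/-- The unmarked boxes of column `m` never outnumber the passes that remain, so every box is
eventually removed. -/
theorem scanHeights_add_le_of_passValue_le {j m : ℕ} (hm : m < μ.rowLen 0) (hjm : j ≤ m)
    (h : ∀ r < μ.colLen m, passValue T μ j (μ.colLen j - 1 - r) m ≤ T r m) {k : ℕ}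
    (hk : k ≤ μ.colLen j) : scanHeights T μ j k m + k ≤ μ.colLen j := by
  induction k with
  | zero => exact μ.colLen_anti j m hjm
  | succ k ih =>
    have ih := ih (by omega)
    have h1 := scanHeights_succ_le T μ j k m
    rcases ih.eq_or_lt with heq | hlt
    -- In the case of equality the bottom unmarked box lies in the row aligned with pass `k`, so the
    -- hypothesis forces a visit.
    · have h2 := scanHeights_le T μ j k m
      have h3 := h (scanHeights T μ j k m - 1) (by omega)
      rw [show μ.colLen j - 1 - (scanHeights T μ j k m - 1) = k by omega] at h3
      rw [scanHeights_succ_of_visits T μ j hm ⟨hjm, by omega, h3⟩]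
      omega
    · omega

/-- The values of the passes, aligned at the top, lie below the next column. -/
theorem passValue_le_entry {j m : ℕ} (hm : m < μ.rowLen 0) (hjm : j ≤ m) :
    ∀ r < μ.colLen m, passValue T μ j (μ.colLen j - 1 - r) m ≤ T r m := by
  induction m, hjm using Nat.le_induction with
  | base =>
    intro r _
    rw [passValue_self]
    exact Nat.zero_le _
  | succ m hjm ih =>
    intro r hr
    have ih := ih (by omega)
    have hr1 : (r, m + 1) ∈ μ := YoungDiagram.mem_iff_lt_colLen.mpr hr
    have hr0 : (r, m) ∈ μ := μ.up_left_mem le_rfl (Nat.le_succ m) hr1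
    have hrm := YoungDiagram.mem_iff_lt_colLen.mp hr0
    have hja := μ.colLen_anti j m hjm
    refine le_trans ?_ (T.row_weak (Nat.lt_succ_self m) hr1)
    by_cases hv : Visits T μ j (μ.colLen j - 1 - r) m
    · rw [passValue_succ_of_visits T μ j hv]
      have h1 := scanHeights_add_le_of_passValue_le T (by omega) hjm ih
        (k := μ.colLen j - 1 - r) (by omega)
      -- The height bound places the visited box in row `r` or above it.
      have h2 := entry_add_le T (i := scanHeights T μ j (μ.colLen j - 1 - r) m - 1) (k := r)
        (by omega) hr0
      omega
    · rw [passValue_succ_of_not_visits T μ j hv]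
      exact ih r hrm

theorem scanHeights_add_le {j m : ℕ} (hm : m < μ.rowLen 0) (hjm : j ≤ m) {k : ℕ}
    (hk : k ≤ μ.colLen j) : scanHeights T μ j k m + k ≤ μ.colLen j :=
  scanHeights_add_le_of_passValue_le T hm hjm (passValue_le_entry T hm hjm) hk

/-- If each column of length `q` is bounded by the set `B q` and these sets avoid 312, then so are
the columns of the scanning tableau. -/
theorem le_countGe_passValue (B : ℕ → Finset ℕ)
    (hcard : ∀ l < μ.rowLen 0, (B (μ.colLen l)).card = μ.colLen l)
    (hsub : ∀ l m, l ≤ m → m < μ.rowLen 0 → B (μ.colLen m) ⊆ B (μ.colLen l))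
    (hav : ∀ l m, l ≤ m → m < μ.rowLen 0 → PairAvoids (B (μ.colLen m)) (B (μ.colLen l)))
    (hT : ∀ i l, (i, l) ∈ μ → μ.colLen l - i ≤ countGe (B (μ.colLen l)) (T i l))
    {j m : ℕ} (hjm : j ≤ m) (hm : m ≤ μ.rowLen 0) (hj : j < μ.rowLen 0) :
    ∀ k < μ.colLen j, k + 1 ≤ countGe (B (μ.colLen j)) (passValue T μ j k m) := by
  induction m, hjm using Nat.le_induction with
  | base =>
    intro k hk
    rw [passValue_self, countGe_zero, hcard j hj]
    omega
  | succ m hjm ih =>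
    have ih := ih (by omega)
    have hm' : m < μ.rowLen 0 := hm
    set H := fun k => scanHeights T μ j k m with hH
    have hH0 : ∀ k, μ.colLen m ≤ H k + k := fun k => le_scanHeights_add T μ j k m
    have hH1 : ∀ k, H k ≤ μ.colLen m := fun k => scanHeights_le T μ j k m
    have hH2 : ∀ k ≤ μ.colLen j, H k + k ≤ μ.colLen j := fun k hk =>
      scanHeights_add_le T hm' hjm hk
    have hcol : ∀ h, 0 < h → h ≤ μ.colLen m → (h - 1, m) ∈ μ := fun h h0 h1 =>
      YoungDiagram.mem_iff_lt_colLen.mpr (by omega)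
    -- Either no pass has yet skipped column `m`, or `d` counts the visits since the last skip. A
    -- skip means that the current bottom entry is smaller than the pass value, which the induction
    -- over columns bounds. Each later visit moves up one row and lowers the entry by at least one,
    -- which the increase of `d` compensates.
    have inv : ∀ k ≤ μ.colLen j, H k + k = μ.colLen m ∨ (0 < H k → ∃ d, d + H k ≤ μ.colLen m ∧
        k ≤ countGe (B (μ.colLen j)) (T (H k - 1) m + d + 1) + d) := by
      intro k hk
      induction k with
      | zero => exact Or.inl rfl
      | succ k ihk =>
        have ihk := ihk (by omega)
        by_cases hv : Visits T μ j k m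
        · have hs : H (k + 1) = H k - 1 := scanHeights_succ_of_visits T μ j hm' hv
          have hpos : 0 < H k := hv.2.1
          rcases ihk with ihk | ihk
          · left
            omega
          · right
            intro hpos'
            obtain ⟨d, hd, hc⟩ := ihk hpos
            clear ihk
            refine ⟨d + 1, by omega, ?_⟩
            have h1 := entry_add_le T (i := H (k + 1) - 1) (k := H k - 1) (by omega)
              (hcol _ hpos (hH1 k))
            have h2 := countGe_anti (B (μ.colLen j))
              (show T (H (k + 1) - 1) m + (d + 1) + 1 ≤ T (H k - 1) m + d + 1 by omega)
            omega
        · have hs : H (k + 1) = H k := scanHeights_succ_of_not_visits T μ j hv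
          right
          intro hpos
          rw [hs] at hpos ⊢
          refine ⟨0, by have := hH1 k; omega, ?_⟩
          have hlt : T (H k - 1) m < passValue T μ j k m := by
            by_contra hcon
            exact hv ⟨hjm, hpos, not_lt.mp hcon⟩
          exact (ih k (by omega)).trans (countGe_anti _ hlt)
    intro k hk
    by_cases hv : Visits T μ j k m
    · rw [passValue_succ_of_visits T μ j hv]
      change k + 1 ≤ countGe _ (T (H k - 1) m)
      have hpos : 0 < H k := hv.2.1
      have hc := hT _ _ (hcol _ hpos (hH1 k))
      have h0 := hH0 k
      have h1 := hH1 k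
      have h2 := hH2 k hk.le
      rcases inv k hk.le with hi | hi
      · have := countGe_mono (hsub j m hjm hm') (T (H k - 1) m)
        omega
      · obtain ⟨d, hd, hd'⟩ := hi hpos
        clear hi
        -- Here `s` comes from the key bound on column `m`, `t` is the number of earlier passes that
        -- skipped this column, and `s + t = k + 1`.
        have := (hav j m hjm hm').le_countGe (hsub j m hjm hm') (v := T (H k - 1) m)
          (s := μ.colLen m - (H k - 1)) (t := k - (μ.colLen m - H k)) (d := d + 1) hc
          (by rw [hcard m hm', hcard j hj]; omega) (by omega) (by
            rw [← add_assoc (T (H k - 1) m)]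
            omega)
        omega
    · rw [passValue_succ_of_not_visits T μ j hv]
      exact ih k hk

/-- The values of the passes decrease strictly. -/
theorem passValue_succ_lt {j m : ℕ} (hj : j < μ.rowLen 0) (hjm : j + 1 ≤ m)
    (hm : m ≤ μ.rowLen 0) : ∀ k, k + 1 < μ.colLen j →
      passValue T μ j (k + 1) m < passValue T μ j k m := by
  induction m, hjm using Nat.le_induction with
  | base =>
    intro k hk
    rw [passValue_self_succ _ _ _ hj hk, passValue_self_succ _ _ _ hj (by omega)]
    exact T.col_strict (by omega) (YoungDiagram.mem_iff_lt_colLen.mpr (by omega))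
  | succ m hjm ih =>
    intro k hk
    have ih := ih (by omega) k hk
    have hm' : m < μ.rowLen 0 := hm
    have hle := passValue_le_succ T μ j k m
    by_cases hv' : Visits T μ j (k + 1) m
    · rw [passValue_succ_of_visits _ _ _ hv']
      have hpos := hv'.2.1
      by_cases hv : Visits T μ j k m
      · have hs := scanHeights_succ_of_visits T μ j hm' hv
        have hH := scanHeights_le T μ j k m
        rw [passValue_succ_of_visits _ _ _ hv]
        exact T.col_strict (by omega) (YoungDiagram.mem_iff_lt_colLen.mpr (by omega))
      · have hs := scanHeights_succ_of_not_visits T μ j hv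
        rw [passValue_succ_of_not_visits _ _ _ hv, hs]
        rw [hs] at hpos
        -- Both passes meet the same box, and pass `k` skipped it only because its own value was
        -- larger.
        by_contra hcon
        exact hv ⟨by omega, hpos, not_lt.mp hcon⟩
    · rw [passValue_succ_of_not_visits _ _ _ hv']
      exact ih.trans_le hle

/-- If the columns of a tableau are subsets of `B`, then so are the values of the passes. -/
theorem passValue_mem {j m : ℕ} (B : Finset ℕ) (hB : ∀ i l, j ≤ l → (i, l) ∈ μ → T i l ∈ B)
    (hj : j < μ.rowLen 0) (hjm : j + 1 ≤ m) :
    ∀ k < μ.colLen j, passValue T μ j k m ∈ B := by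
  induction m, hjm using Nat.le_induction with
  | base =>
    intro k hk
    rw [passValue_self_succ _ _ _ hj hk]
    exact hB _ _ le_rfl (YoungDiagram.mem_iff_lt_colLen.mpr (by omega))
  | succ m hjm ih =>
    intro k hk
    by_cases hv : Visits T μ j k m
    · rw [passValue_succ_of_visits _ _ _ hv]
      have hpos := hv.2.1
      have hH := scanHeights_le T μ j k m
      exact hB _ _ (by omega) (YoungDiagram.mem_iff_lt_colLen.mpr (by omega))
    · rw [passValue_succ_of_not_visits _ _ _ hv]
      exact ih k hk

/-- The values of passes `0, ..., k` are `k + 1` distinct elements of `B`, and the last of them is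
the smallest. -/
theorem le_countGe_passValue_of_mem {j : ℕ} (B : Finset ℕ)
    (hB : ∀ i l, j ≤ l → (i, l) ∈ μ → T i l ∈ B) (hj : j < μ.rowLen 0) {k : ℕ}
    (hk : k < μ.colLen j) : k + 1 ≤ countGe B (passValue T μ j k (μ.rowLen 0)) := by
  have hlt : ∀ k l, k < l → l < μ.colLen j →
      passValue T μ j l (μ.rowLen 0) < passValue T μ j k (μ.rowLen 0) := by
    intro k l hkl hl
    induction l, hkl using Nat.le_induction with
    | base => exact passValue_succ_lt T hj hj le_rfl k hl
    | succ l hkl ih => exact (passValue_succ_lt T hj hj le_rfl l hl).trans (ih (by omega))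
  have hinj : Set.InjOn (fun l => passValue T μ j l (μ.rowLen 0)) (range (k + 1)) := by
    intro x hx y hy hxy
    simp only [coe_range, Set.mem_Iio] at hx hy hxy
    rcases lt_trichotomy x y with h | h | h
    · have := hlt x y h (by omega)
      omega
    · exact h
    · have := hlt y x h (by omega)
      omega
  rw [← card_range (k + 1), ← card_image_of_injOn hinj]
  refine card_le_card (fun y hy => ?_)
  obtain ⟨l, hl, rfl⟩ := mem_image.mp hy
  rw [mem_range] at hl
  refine mem_filter.mpr ⟨passValue_mem T B hB hj hj l (by omega), ?_⟩
  rcases (show l ≤ k by omega).eq_or_lt with rfl | h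
  · exact le_rfl
  · exact (hlt l k h hk).le

end Tableau

/-! ### Cores -/

section Core

variable {n : ℕ} {R : Finset ℕ} {υ : Fin n → Fin n}

theorem IsCritical.gap_lt {x : Fin n} (hx : IsCritical R υ x) :
    ∀ y : Fin n, x < y → (y : ℕ) < carrelEnd R n x → (y : ℤ) - x < (υ y : ℤ) - υ x := by
  induction hx with
  | last x hx =>
    intro y hxy hy
    rw [Fin.lt_def] at hxy
    omega
  | next x x' hx' hc hlt hgap hmax ih =>
    intro y hxy hy
    have hxx' := (sameCarrel_iff hlt.le x'.isLt).mp hc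
    rcases lt_trichotomy y x' with h | rfl | h
    · have := hmax y hxy h
      omega
    · exact hgap
    · have := ih y h (by rw [carrelEnd_eq hlt.le hxx']; exact hy)
      omega

open Classical in
theorem nextCritical_spec (R : Finset ℕ) (υ : Fin n → Fin n) (i : Fin n) :
    i ≤ nextCritical R υ i ∧ IsCritical R υ (nextCritical R υ i) ∧
      ∀ x, i ≤ x → IsCritical R υ x → nextCritical R υ i ≤ x := by
  have h := min'_mem _ (exists_critical_ge R υ i)
  rw [mem_filter] at h
  exact ⟨h.2.1, h.2.2, fun x hx hx' => min'_le _ _ (mem_filter.mpr ⟨mem_univ _, hx, hx'⟩)⟩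

theorem nextCritical_lt_carrelEnd (R : Finset ℕ) (υ : Fin n → Fin n) (i : Fin n) :
    (nextCritical R υ i : ℕ) < carrelEnd R n i := by
  have h1 := lt_carrelEnd (R := R) i.isLt
  have h2 := carrelEnd_le R n i
  have h3 := (nextCritical_spec R υ i).2.2 ⟨carrelEnd R n i - 1, by omega⟩
    (by rw [Fin.le_def]; simp only; omega)
    (IsCritical.last _ (by
      simp only
      rw [carrelEnd_eq (i := i) (by omega) (by omega)]
      omega))
  rw [Fin.le_def] at h3
  simp only at h3
  omega

/-- The next critical index minimizes `υ j - j` over the rest of the carrel. So the core at `i` is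
`i` plus this minimum, which `core_add_le` and `exists_core_add_eq` express in place of the
definition. -/
theorem nextCritical_gap_le (R : Finset ℕ) (υ : Fin n → Fin n) (i : Fin n) :
    ∀ j : Fin n, i ≤ j → (j : ℕ) < carrelEnd R n i →
      (υ (nextCritical R υ i) : ℤ) - nextCritical R υ i ≤ (υ j : ℤ) - j := by
  obtain ⟨hi, hcrit, hmin⟩ := nextCritical_spec R υ i
  have hlt := nextCritical_lt_carrelEnd R υ i
  set x := nextCritical R υ i
  intro j hij hj
  rcases lt_trichotomy j x with h | rfl | h
  · by_contra hcon
    -- The largest violating index in `[i, x)` would itself be critical, against the minimality of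
    -- `x`.
    have hne : (univ.filter (fun y : Fin n => i ≤ y ∧ y < x ∧
        (x : ℤ) - y < (υ x : ℤ) - υ y)).Nonempty :=
      ⟨j, mem_filter.mpr ⟨mem_univ _, hij, h, by omega⟩⟩
    have hmem := max'_mem _ hne
    set y := max' _ hne with hy
    obtain ⟨-, hiy, hyx, hgap⟩ := mem_filter.mp hmem
    have hyc : IsCritical R υ y := by
      refine IsCritical.next y x hcrit ?_ hyx hgap (fun z hyz hzx hz => ?_)
      · rw [sameCarrel_iff hyx.le x.isLt, carrelEnd_eq hiy (by rw [Fin.lt_def] at hyx; omega)]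
        exact hlt
      · have : z ≤ y :=
          le_max' _ z (mem_filter.mpr ⟨mem_univ _, hiy.trans hyz.le, hzx, hz⟩)
        exact absurd (hyz.trans_le this) (lt_irrefl _)
    exact absurd (hyx.trans_le (hmin y hiy hyc)) (lt_irrefl _)
  · exact le_rfl
  · have := hcrit.gap_lt j h (by rw [carrelEnd_eq hi hlt]; exact hj)
    omega

theorem core_add_le (hυ : IsUpper υ) {i j : Fin n} (hij : i ≤ j)
    (hj : (j : ℕ) < carrelEnd R n i) : (core R υ i : ℕ) + (j - i) ≤ υ j := by
  have h1 := nextCritical_gap_le R υ i j hij hj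
  have h2 := (nextCritical_spec R υ i).1
  have h3 := hυ (nextCritical R υ i)
  rw [Fin.le_def] at hij h2 h3
  unfold core
  simp only
  omega

theorem exists_core_add_eq (R : Finset ℕ) (hυ : IsUpper υ) (i : Fin n) :
    ∃ j : Fin n, i ≤ j ∧ (j : ℕ) < carrelEnd R n i ∧ (core R υ i : ℕ) + (j - i) = υ j := by
  have h2 := (nextCritical_spec R υ i).1
  have h3 := hυ (nextCritical R υ i)
  refine ⟨nextCritical R υ i, h2, nextCritical_lt_carrelEnd R υ i, ?_⟩
  rw [Fin.le_def] at h2 h3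
  unfold core
  simp only
  omega

theorem core_le (hυ : IsUpper υ) (i : Fin n) : (core R υ i : ℕ) ≤ υ i :=
  le_trans (Nat.le_add_right _ _) (core_add_le hυ le_rfl (lt_carrelEnd i.isLt))

theorem isUpper_core (R : Finset ℕ) (hυ : IsUpper υ) : IsUpper (core R υ) := by
  intro i
  obtain ⟨j, hij, -, h⟩ := exists_core_add_eq R hυ i
  have := hυ j
  rw [Fin.le_def] at *
  omega

theorem isRIncreasing_core (R : Finset ℕ) (hυ : IsUpper υ) : IsRIncreasing R (core R υ) := by
  intro i i' hii' hc
  obtain ⟨j, hij, hj, h⟩ := exists_core_add_eq R hυ i'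
  have hc' := (sameCarrel_iff hii'.le i'.isLt).mp hc
  have h1 := core_add_le (R := R) hυ (hii'.le.trans hij)
    (by rw [carrelEnd_eq hii'.le hc'] at hj; exact hj)
  rw [Fin.lt_def] at *
  rw [Fin.le_def] at hij
  omega

theorem IsRIncreasing.add_le {γ : Fin n → Fin n} (hγ : IsRIncreasing R γ) {i j : Fin n}
    (hij : i ≤ j) (hj : (j : ℕ) < carrelEnd R n i) : (γ i : ℕ) + (j - i) ≤ γ j := by
  have key : ∀ k : ℕ, ∀ h : (i : ℕ) + k < n, (i : ℕ) + k < carrelEnd R n i →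
      (γ i : ℕ) + k ≤ γ ⟨i + k, h⟩ := by
    intro k
    induction k with
    | zero => exact fun _ _ => le_rfl
    | succ k ih =>
      intro h h'
      have h1 := ih (by omega) (by omega)
      have h2 := hγ ⟨i + k, by omega⟩ ⟨i + (k + 1), h⟩ (by rw [Fin.lt_def]; simp only; omega)
        ((sameCarrel_iff (by simp only; omega) h).mpr (by
          simp only
          rw [carrelEnd_eq (i := i) (by omega) (by omega)]
          exact h'))
      rw [Fin.lt_def] at h2
      omega
  rw [Fin.le_def] at hij
  have := key (j - i) (by omega) (by omega)
  rwa [show (⟨i + (j - i), by omega⟩ : Fin n) = j from Fin.ext (by simp only; omega)] at this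

/-- The core of an upper flag is gapless. -/
theorem IsUpperFlag.isGapless_core {φ : Fin n → Fin n} (hφ : IsUpperFlag φ) (R : Finset ℕ) :
    IsGapless R (core R φ) := by
  refine ⟨isRIncreasing_core R hφ.1, isUpper_core R hφ.1, ?_⟩
  intro a b hb hab hlt s hs
  -- Monotonicity of `φ` gives `core a ≤ φ a ≤ φ j = core b + (j - b)`, so `s ≤ j - b + 1`. Between
  -- `b` and `j` the core rises in unit steps, squeezed between its strict increase and the bound `φ
  -- j`.
  obtain ⟨j, hbj, hj, h⟩ := exists_core_add_eq R hφ.1 b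
  have ha := core_le (R := R) hφ.1 a
  have haj : φ a ≤ φ j := hφ.2 (by rw [Fin.le_def] at *; omega)
  rw [Fin.le_def] at haj hbj
  rw [Fin.lt_def] at hlt
  refine ⟨by omega, ?_⟩
  intro k hk c hc
  have h1 := (isRIncreasing_core R hφ.1).add_le (i := b) (j := c) (by rw [Fin.le_def]; omega)
    (by omega)
  have h2 := core_add_le (R := R) hφ.1 (i := c) (j := j) (by rw [Fin.le_def]; omega) (by
    rw [carrelEnd_eq (i := (b : ℕ)) (by omega) (by omega)]
    exact hj)
  omega

theorem isGapless_entry {γ : Fin n → Fin n} (hγ : IsGapless R γ) {a b c : Fin n}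
    (hb : (b : ℕ) ∈ R) (hab : (a : ℕ) + 1 = b) (hle : γ b ≤ γ a) :
    (γ a : ℕ) - γ b + 1 ≤ carrelEnd R n b - b ∧
      ((c : ℕ) < b + (γ a - γ b + 1) → b ≤ c → (γ c : ℕ) = γ b + (c - b)) := by
  have hbe := lt_carrelEnd (R := R) b.isLt
  rcases hle.eq_or_lt with heq | hlt
  · rw [heq]
    refine ⟨by omega, fun hc hbc => ?_⟩
    rw [Fin.le_def] at hbc
    obtain rfl : c = b := Fin.ext (by omega)
    rw [heq]
    omega
  · obtain ⟨h1, h2⟩ := hγ.2.2 a b hb hab hlt _ rfl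
    refine ⟨h1, fun hc hbc => ?_⟩
    rw [Fin.le_def] at hbc
    rw [Fin.lt_def] at hlt
    have := h2 (c - b) (by omega) c (by omega)
    omega

/-- The last entry of each carrel of a gapless tuple is the largest one so far. -/
theorem IsGapless.le_last {γ : Fin n → Fin n} (hγ : IsGapless R γ) (i e : Fin n)
    (hie : i ≤ e) (he : carrelEnd R n e = e + 1) : γ i ≤ γ e := by
  induction e using Fin.strong_induction_on with
  | _ e ih =>
    by_cases hsame : (e : ℕ) < carrelEnd R n i
    · have := hγ.1.add_le hie hsame
      rw [Fin.le_def]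
      omega
    · have hlt' := lt_carrelEnd (R := R) i.isLt
      have hqs : carrelStart R e ≠ 0 := by
        intro h0
        rcases carrelEnd_mem R n i with h | h
        · have := le_carrelStart h (not_lt.mp hsame)
          omega
        · omega
      have hq := carrelStart_mem R e hqs
      have hqe := carrelStart_le R e
      have hiq : (i : ℕ) < carrelStart R e := by
        rcases carrelEnd_mem R n i with h | h
        · have := le_carrelStart h (not_lt.mp hsame)
          omega
        · omega
      obtain ⟨hE, -⟩ := carrelEnd_carrelStart (R := R) e.isLt
      set q := carrelStart R e with hqdef
      have hIH := ih ⟨q - 1, by omega⟩ (by rw [Fin.lt_def]; simp only; omega)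
        (by rw [Fin.le_def]; simp only; omega) (by
          simp only
          have h1 := carrelEnd_le_of_mem (n := n) hq (show q - 1 < q by omega)
          have h2 := lt_carrelEnd (R := R) (n := n) (i := q - 1) (by omega)
          omega)
      refine hIH.trans ?_
      have hqe' : (⟨q, by omega⟩ : Fin n) ≤ e := hqe
      rcases le_total (γ ⟨q - 1, by omega⟩) (γ ⟨q, by omega⟩) with h | h
      · refine h.trans ?_
        have := hγ.1.add_le hqe' (by simp only; omega)
        rw [Fin.le_def]
        omega
      · obtain ⟨h1, -⟩ := isGapless_entry (c := e) hγ (a := ⟨q - 1, by omega⟩) (b := ⟨q, by omega⟩)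
          hq (by simp only; omega) h
        rw [Fin.le_def] at h ⊢
        have := hγ.1.add_le hqe' (by simp only; omega)
        simp only at h1 this
        omega

/-! ### From gapless tuples to flags -/

/-- The smallest upper flag above a tuple. -/
def runningMax (γ : Fin n → Fin n) (i : Fin n) : Fin n :=
  (Iic i).sup' ⟨i, mem_Iic.mpr le_rfl⟩ γ

theorem le_runningMax (γ : Fin n → Fin n) (i : Fin n) : γ i ≤ runningMax γ i :=
  le_sup' γ (mem_Iic.mpr le_rfl)

theorem isUpperFlag_runningMax {γ : Fin n → Fin n} (hγ : IsUpper γ) :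
    IsUpperFlag (runningMax γ) :=
  ⟨fun i => (hγ i).trans (le_runningMax γ i),
    fun _ _ hij => sup'_mono γ (Iic_subset_Iic.mpr hij) _⟩

/-- If `γ i` is not a maximum so far, the maximum comes from an earlier carrel and equals `A = γ (q
- 1)`, with `q` the start of the carrel of `i`. Gaplessness makes the carrel begin `B, B + 1, ...,
A`, where `B = γ q`. The witness is the index where `A` is reached again. -/
theorem IsGapless.exists_runningMax_eq {γ : Fin n → Fin n} (hγ : IsGapless R γ) (i : Fin n) :
    ∃ j : Fin n, i ≤ j ∧ (j : ℕ) < carrelEnd R n i ∧ (runningMax γ j : ℕ) = γ i + (j - i) := by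
  have hie := lt_carrelEnd (R := R) i.isLt
  by_cases hmax : ∀ k ≤ i, γ k ≤ γ i
  · refine ⟨i, le_rfl, hie, ?_⟩
    have : runningMax γ i = γ i :=
      le_antisymm (sup'_le _ _ (fun k hk => hmax k (mem_Iic.mp hk))) (le_runningMax γ i)
    rw [this]
    omega
  · push Not at hmax
    obtain ⟨k, hki, hk⟩ := hmax
    have hsi := carrelStart_le R i
    obtain ⟨hE, hiE⟩ := carrelEnd_carrelStart (R := R) i.isLt
    have hks : (k : ℕ) < carrelStart R i := by
      by_contra hcon
      have h1 : carrelEnd R n k = carrelEnd R n i := by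
        rw [carrelEnd_eq (not_lt.mp hcon) (by rw [Fin.le_def] at hki; omega), hE]
      have := hγ.1.add_le hki (by omega)
      rw [Fin.lt_def] at hk
      omega
    have hq := carrelStart_mem R i (by omega)
    set q := carrelStart R i with hqdef
    have hlast : ∀ l : Fin n, (l : ℕ) < q → γ l ≤ γ ⟨q - 1, by omega⟩ := by
      intro l hl
      refine hγ.le_last _ _ (by rw [Fin.le_def]; simp only; omega) ?_
      simp only
      have h1 := carrelEnd_le_of_mem (n := n) hq (show q - 1 < q by omega)
      have h2 := lt_carrelEnd (R := R) (n := n) (i := q - 1) (by omega)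
      omega
    have hka := hlast k hks
    have hbi := hγ.1.add_le (i := ⟨q, by omega⟩) (j := i) hsi (by simp only; omega)
    have hle : γ ⟨q, by omega⟩ ≤ γ ⟨q - 1, by omega⟩ := by
      rw [Fin.le_def, Fin.lt_def] at *
      omega
    have hent := fun c => isGapless_entry (c := c) hγ (a := ⟨q - 1, by omega⟩)
      (b := ⟨q, by omega⟩) hq (by simp only; omega) hle
    obtain ⟨h1, -⟩ := hent i
    have hle' := hle
    rw [Fin.le_def] at hle hka
    rw [Fin.lt_def] at hk
    simp only at h1
    have hq' := carrelEnd_le R n q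
    set A := (γ ⟨q - 1, by omega⟩ : ℕ) with hA
    set B := (γ ⟨q, by omega⟩ : ℕ) with hB
    have hj : q + (A - B) < n := by omega
    have hentj := (hent ⟨q + (A - B), hj⟩).2 (by simp only; omega)
      (by rw [Fin.le_def]; simp only; omega)
    simp only at hbi hentj
    have hij : (i : ℕ) ≤ q + (A - B) := by omega
    have henti := (hent i).2 (by simp only; omega) (by rw [Fin.le_def]; simp only; omega)
    simp only at henti
    refine ⟨⟨q + (A - B), hj⟩, by rw [Fin.le_def]; exact hij, by simp only; omega, ?_⟩
    have hjA : (γ ⟨q + (A - B), hj⟩ : ℕ) = A := by omega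
    have : runningMax γ ⟨q + (A - B), hj⟩ = γ ⟨q + (A - B), hj⟩ := by
      refine le_antisymm (sup'_le _ _ (fun l hl => ?_)) (le_runningMax γ _)
      have hl := mem_Iic.mp hl
      rw [Fin.le_def] at hl ⊢
      simp only at hl
      by_cases hlq : (l : ℕ) < q
      · have := hlast l hlq
        rw [Fin.le_def] at this
        omega
      · have h2 : carrelEnd R n l = carrelEnd R n i := by
          rw [carrelEnd_eq (not_lt.mp hlq) (by omega), hE]
        have := hγ.1.add_le (i := l) (j := ⟨q + (A - B), hj⟩) hl (by simp only; omega)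
        omega
    rw [this, hjA]
    simp only
    omega

end Core

/-! ### Avoiding permutations and gapless tuples -/

section Perm

variable {n : ℕ} [NeZero n] {R : Finset ℕ}

theorem IsAvoiding.isGapless_rankTuple {π : Fin n → Fin n} (hπ : IsAvoiding R π) :
    IsGapless R (rankTuple R π) := by
  have hinj := hπ.1.1
  refine ⟨?_, ?_, ?_⟩
  · intro i j hij hc
    have h1 := (sameCarrel_iff hij.le j.isLt).mp hc
    rw [Fin.lt_def, val_rankTuple R hinj, val_rankTuple R hinj, carrelEnd_eq hij.le h1]
    rw [Fin.lt_def] at hij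
    refine rank_lt_rank (by omega) (by omega) ?_
    rw [card_prefixSet hinj (carrelEnd_le R n i)]
    omega
  · intro i
    rw [Fin.le_def, le_rankTuple_iff hinj]
    have h1 := card_prefixSet hinj (carrelEnd_le R n i)
    have h2 := card_filter_add_card_filter_not
      (s := prefixSet π (carrelEnd R n i)) (fun y => (i : ℕ) ≤ y)
    have h3 : ((prefixSet π (carrelEnd R n i)).filter (fun y => ¬ (i : ℕ) ≤ y)).card ≤ i := by
      refine (card_le_card (t := range i) (fun x hx => ?_)).trans_eq (card_range _)
      have := (mem_filter.mp hx).2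
      rw [mem_range]
      omega
    unfold countGe
    omega
  · intro a b hb hab hlt s hs
    have hbe := lt_carrelEnd (R := R) b.isLt
    have hae : carrelEnd R n a = b := by
      have h1 := carrelEnd_le_of_mem (n := n) hb (show (a : ℕ) < b by omega)
      have h2 := lt_carrelEnd (R := R) a.isLt
      omega
    have hen := carrelEnd_le R n b
    have he := carrelEnd_mem R n b
    have hcB := card_prefixSet hinj hen
    have hcB' := card_prefixSet hinj b.isLt.le
    have hval := val_rankTuple R hinj b
    have hvala := val_rankTuple R hinj a
    rw [Fin.lt_def] at hlt
    set x := (rankTuple R π b : ℕ)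
    set M := (rankTuple R π a : ℕ)
    rw [hae, show (b : ℕ) - a = 1 by omega] at hvala
    set e := carrelEnd R n b with hedef
    have hsub := prefixSet_mono π hbe.le
    have hP := pairAvoids_prefixSet (q := b) hinj hπ.2 (Or.inl hb) he
    obtain ⟨hxm, hxc⟩ := rank_mem_and_countGe (Q := prefixSet π e) (d := e - b) (by omega)
      (by omega)
    obtain ⟨hMm, -⟩ := rank_mem_and_countGe (Q := prefixSet π b) (d := 1) le_rfl
      (by omega)
    rw [← hval] at hxm hxc
    rw [← hvala] at hMm
    -- If all `e - b` new values were `≥ x`, then together with `M` there would be more than the `e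
    -- - b` elements that the rank of `x` permits. The small new value lets avoidance fill the
    -- interval from `x` to `M`.
    have hnew : ∃ y ∈ prefixSet π e, y ∉ prefixSet π b ∧ y < x := by
      by_contra! hcon
      have h1 : insert M (prefixSet π e \ prefixSet π b) ⊆
          (prefixSet π e).filter (fun y => x ≤ y) := by
        intro y hy
        rcases mem_insert.mp hy with rfl | hy
        · exact mem_filter.mpr ⟨hsub hMm, hlt.le⟩
        · rw [mem_sdiff] at hy
          exact mem_filter.mpr ⟨hy.1, hcon y hy.1 hy.2⟩
      have h2 := card_le_card h1
      rw [card_insert_of_notMem (fun h => (mem_sdiff.mp h).2 hMm)] at h2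
      have h3 := card_sdiff_add_card_eq_card hsub
      unfold countGe at hxc
      omega
    obtain ⟨y, hy, hy', hyx⟩ := hnew
    have hint : ∀ z, x ≤ z → z ≤ M → z ∈ prefixSet π e := by
      intro z hxz hzM
      rcases hzM.eq_or_lt with rfl | hzM
      · exact hsub hMm
      · exact hP M hMm y hy hy' z (by omega) hzM
    have hcount : ∀ k, k < s → e - b = k + countGe (prefixSet π e) (x + k) := by
      intro k hk
      rw [← hxc]
      refine countGe_eq_add_of_Ico_subset (fun z hz => ?_)
      rw [mem_Ico] at hz
      exact hint z hz.1 (by omega)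
    have hposM : 1 ≤ countGe (prefixSet π e) (x + (s - 1)) :=
      card_pos.mpr ⟨M, mem_filter.mpr ⟨hsub hMm, by omega⟩⟩
    have hs' := hcount (s - 1) (by omega)
    refine ⟨by omega, fun k hk c hc => ?_⟩
    have h1 := hcount k hk
    rw [val_rankTuple R hinj c, carrelEnd_eq (i := (b : ℕ)) (by omega) (by omega), ← hedef,
      rank_eq_of_countGe (hint (x + k) (by omega) (by omega)) (by omega)]
    omega

/-! ### The permutation of a gapless tuple -/

theorem PairAvoids.trans {B₁ B₂ B₃ : Finset ℕ} (h₁₂ : PairAvoids B₁ B₂) (h₂₃ : PairAvoids B₂ B₃)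
    (hs : B₁ ⊆ B₂) (hs' : B₂ ⊆ B₃) : PairAvoids B₁ B₃ := by
  intro a ha b hb hb' x hbx hxa
  by_cases h : b ∈ B₂
  · exact hs' (h₁₂ a ha b h hb' x hbx hxa)
  · exact h₂₃ a (hs ha) b hb h x hbx hxa

theorem le_of_countGe_eq_one {B : Finset ℕ} {v : ℕ} (hv : v ∈ B) (h : countGe B v = 1) :
    ∀ y ∈ B, y ≤ v := by
  intro y hy
  by_contra hcon
  have := card_le_one.mp h.le y (mem_filter.mpr ⟨hy, (not_le.mp hcon).le⟩) v
    (mem_filter.mpr ⟨hv, le_rfl⟩)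
  omega

theorem card_filter_le_lt {n r e : ℕ} (he : e ≤ n) :
    (univ.filter (fun k : Fin n => r ≤ (k : ℕ) ∧ (k : ℕ) < e)).card = e - r := by
  have : (univ.filter (fun k : Fin n => r ≤ (k : ℕ) ∧ (k : ℕ) < e)).image Fin.val = Ico r e := by
    ext y
    simp only [mem_image, mem_filter, mem_univ, true_and, mem_Ico]
    constructor
    · rintro ⟨k, hk, rfl⟩
      exact hk
    · intro hy
      exact ⟨⟨y, by omega⟩, hy, rfl⟩
  rw [← card_image_of_injective _ Fin.val_injective, this, Nat.card_Ico]

section Extend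

variable {n : ℕ} {π γ : Fin n → Fin n} {q s e U : ℕ}

/-- The properties of a permutation on the indices less than `e` that are inherited from one carrel
`[q, e)` to the next. Here `π` consists on `[q, e)` of the `s` largest missing values below `U` and
of values of `γ` that are at least `U`. -/
theorem extend_carrel (hqs : q + s ≤ e) (hen : e ≤ n) (hU : q + s ≤ U)
    (hB : prefixSet π q ⊆ range U)
    (hinj : ∀ i j : Fin n, (i : ℕ) < q → (j : ℕ) < q → π i = π j → i = j)
    (hinc : ∀ i j : Fin n, q ≤ i → i < j → (j : ℕ) < e → γ i < γ j)
    (H1 : ∀ i : Fin n, q ≤ i → (i : ℕ) < q + s →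
      (π i : ℕ) = rank (range U \ prefixSet π q) (q + s - i))
    (H2 : ∀ i : Fin n, q + s ≤ i → (i : ℕ) < e → π i = γ i)
    (H3 : ∀ i : Fin n, q ≤ i → (i : ℕ) < q + s → (γ i : ℕ) + (q + s) = U + i)
    (H4 : ∀ i : Fin n, q + s ≤ i → (i : ℕ) < e → U ≤ γ i) :
    (∀ i j : Fin n, q ≤ i → i < j → (j : ℕ) < e → π i < π j) ∧
    (∀ i j : Fin n, (i : ℕ) < e → (j : ℕ) < e → π i = π j → i = j) ∧
    (∀ i : Fin n, q ≤ i → (i : ℕ) < e →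
      (γ i : ℕ) ∈ prefixSet π e ∧ countGe (prefixSet π e) (γ i) = e - i) ∧
    PairAvoids (prefixSet π q) (prefixSet π e) := by
  have hcard := card_prefixSet_of_injOn (by omega) hinj
  set C := range U \ prefixSet π q with hC
  have hcC : C.card = U - q := by
    rw [hC, card_sdiff_of_subset hB, card_range, hcard]
  have hrankC : ∀ i : Fin n, q ≤ i → (i : ℕ) < q + s → (π i : ℕ) ∈ C := by
    intro i hi hi'
    rw [H1 i hi hi']
    exact (rank_mem_and_countGe (by omega) (by omega)).1
  have hlow : ∀ i : Fin n, (i : ℕ) < q + s → (π i : ℕ) < U := by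
    intro i hi
    by_cases hq : (i : ℕ) < q
    · exact mem_range.mp (hB (mem_prefixSet.mpr ⟨i, hq, rfl⟩))
    · exact mem_range.mp (mem_sdiff.mp (hrankC i (not_lt.mp hq) hi)).1
  have hπinc : ∀ i j : Fin n, q ≤ i → i < j → (j : ℕ) < e → π i < π j := by
    intro i j hi hij hj
    by_cases hjs : (j : ℕ) < q + s
    · rw [Fin.lt_def] at hij ⊢
      rw [H1 i hi (by omega), H1 j (by omega) hjs]
      exact rank_lt_rank (by omega) (by omega) (by omega)
    · rw [H2 j (by omega) hj]
      by_cases his : (i : ℕ) < q + s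
      · rw [Fin.lt_def]
        exact (hlow i his).trans_le (H4 j (by omega) hj)
      · rw [Fin.lt_def] at hij
        rw [H2 i (by omega) (by omega)]
        exact hinc i j hi hij hj
  have hnot : ∀ i j : Fin n, (i : ℕ) < q → q ≤ j → (j : ℕ) < e → π i ≠ π j := by
    intro i j hi hj hj' hij
    have hiq : (π i : ℕ) ∈ prefixSet π q := mem_prefixSet.mpr ⟨i, hi, rfl⟩
    by_cases hjs : (j : ℕ) < q + s
    · rw [hij] at hiq
      exact (mem_sdiff.mp (hrankC j hj hjs)).2 hiq
    · have h1 := hlow i (by omega)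
      have h2 := H4 j (by omega) hj'
      rw [hij, H2 j (by omega) hj'] at h1
      omega
  have htop : ∀ z ∈ C, countGe C z ≤ s → z ∈ prefixSet π e := by
    intro z hz hzs
    have h1 : 1 ≤ countGe C z := card_pos.mpr ⟨z, mem_filter.mpr ⟨hz, le_rfl⟩⟩
    refine mem_prefixSet.mpr ⟨⟨q + s - countGe C z, by omega⟩, by simp only; omega, ?_⟩
    rw [H1 _ (by simp only; omega) (by simp only; omega)]
    simp only
    rw [show q + s - (q + s - countGe C z) = countGe C z by omega]
    exact rank_eq_of_countGe hz rfl
  -- At most `s` numbers lie in `[z, U)`, so a missing `z` is among the `s` largest missing values.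
  have hmid : ∀ z, U ≤ z + s → z < U → z ∈ prefixSet π e := by
    intro z hz hzU
    by_cases hzq : z ∈ prefixSet π q
    · exact prefixSet_mono π (by omega) hzq
    · refine htop z (mem_sdiff.mpr ⟨mem_range.mpr hzU, hzq⟩) ?_
      have : C.filter (fun y => z ≤ y) ⊆ Ico z U := by
        intro y hy
        rw [mem_filter, hC, mem_sdiff, mem_range] at hy
        exact mem_Ico.mpr ⟨hy.2, hy.1.1⟩
      have := card_le_card this
      rw [Nat.card_Ico] at this
      unfold countGe
      omega
  -- Values `≥ U` arise only from the tail of the carrel, where `π` agrees with `γ`.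
  have hcount : ∀ v r, U ≤ v → q + s ≤ r →
      (∀ k : Fin n, q + s ≤ k → (k : ℕ) < e → (v ≤ γ k ↔ r ≤ k)) →
      countGe (prefixSet π e) v = e - r := by
    intro v r hv hr hvr
    have h1 : (prefixSet π e).filter (fun y => v ≤ y) =
        (univ.filter (fun k : Fin n => r ≤ (k : ℕ) ∧ (k : ℕ) < e)).image (fun k => (γ k : ℕ)) := by
      ext y
      rw [mem_filter, mem_prefixSet, mem_image]
      constructor
      · rintro ⟨⟨k, hk, rfl⟩, hvk⟩
        have hks : q + s ≤ k := by
          by_contra hcon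
          have := hlow k (by omega)
          omega
        rw [H2 k hks hk] at hvk ⊢
        exact ⟨k, mem_filter.mpr ⟨mem_univ _, (hvr k hks hk).mp hvk, hk⟩, rfl⟩
      · rintro ⟨k, hk, rfl⟩
        obtain ⟨-, hrk, hke⟩ := mem_filter.mp hk
        exact ⟨⟨k, hke, by rw [H2 k (by omega) hke]⟩, (hvr k (by omega) hke).mpr hrk⟩
    unfold countGe
    rw [h1, card_image_of_injOn, card_filter_le_lt hen]
    intro i hi j hj hij
    simp only [coe_filter, mem_univ, true_and, Set.mem_ofPred_eq] at hi hj hij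
    rcases lt_trichotomy i j with h | h | h
    · have := hinc i j (by omega) h hj.2
      rw [Fin.lt_def] at this
      omega
    · exact h
    · have := hinc j i (by omega) h hi.2
      rw [Fin.lt_def] at this
      omega
  refine ⟨hπinc, ?_, ?_, ?_⟩
  · intro i j hi hj hij
    by_cases hiq : (i : ℕ) < q <;> by_cases hjq : (j : ℕ) < q
    · exact hinj i j hiq hjq hij
    · exact absurd hij (hnot i j hiq (not_lt.mp hjq) hj)
    · exact absurd hij.symm (hnot j i hjq (not_lt.mp hiq) hi)
    · rcases lt_trichotomy i j with h | h | h
      · exact absurd hij (hπinc i j (not_lt.mp hiq) h hj).ne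
      · exact h
      · exact absurd hij (hπinc j i (not_lt.mp hjq) h hi).ne'
  · intro i hi hie
    by_cases his : (i : ℕ) < q + s
    · have h3 := H3 i hi his
      refine ⟨hmid _ (by omega) (by omega), ?_⟩
      have h5 : Ico (γ i : ℕ) (γ i + (q + s - i)) ⊆ prefixSet π e := by
        intro z hz
        rw [mem_Ico] at hz
        exact hmid z (by omega) (by omega)
      rw [countGe_eq_add_of_Ico_subset h5, hcount _ (q + s) (by omega) le_rfl]
      · omega
      · intro k hk hke
        have := H4 k hk hke
        omega
    · refine ⟨mem_prefixSet.mpr ⟨i, hie, by rw [H2 i (by omega) hie]⟩, ?_⟩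
      refine hcount _ _ (H4 i (by omega) hie) (by omega) (fun k hk hke => ?_)
      constructor
      · intro h
        by_contra hcon
        have := hinc k i (by omega) (by rw [Fin.lt_def]; omega) hie
        rw [Fin.lt_def] at this
        omega
      · intro h
        rcases h.eq_or_lt with h | h
        · rw [Fin.ext h]
        · exact (hinc i k hi h hke).le
  · intro a ha b hb hb' x hbx hxa
    by_cases hx : x ∈ prefixSet π q
    · exact prefixSet_mono π (by omega) hx
    have haU := mem_range.mp (hB ha)
    have hxC : x ∈ C := mem_sdiff.mpr ⟨mem_range.mpr (by omega), hx⟩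
    obtain ⟨k, hk, rfl⟩ := mem_prefixSet.mp hb
    have hkq : q ≤ k := by
      by_contra hcon
      exact hb' (mem_prefixSet.mpr ⟨k, by omega, rfl⟩)
    have hks : (k : ℕ) < q + s := by
      by_contra hcon
      have := H4 k (by omega) hk
      rw [H2 k (by omega) hk] at hbx
      omega
    -- The smallest value `b` of the pattern is one of the `s` largest missing values, so the larger
    -- missing `x` is one too.
    refine htop x hxC ((countGe_anti C hbx.le).trans ?_)
    rw [H1 k hkq hks, (rank_mem_and_countGe (by omega) (by omega)).2]
    omega

theorem image_val_Iic_sdiff (π : Fin n → Fin n) (M : Fin n) (q : ℕ) :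
    (Iic M \ (univ : Finset {j : Fin n // (j : ℕ) < q}).image (fun j => π j.1)).image Fin.val
      = range (M + 1) \ prefixSet π q := by
  ext y
  simp only [mem_image, mem_sdiff, mem_Iic, mem_univ, true_and, Subtype.exists, mem_range,
    mem_prefixSet, not_exists, not_and, exists_prop]
  constructor
  · rintro ⟨z, ⟨hz, hz'⟩, rfl⟩
    exact ⟨Nat.lt_succ_of_le hz, fun k hk h => hz' k hk (Fin.ext h)⟩
  · rintro ⟨hy, hy'⟩
    have := M.isLt
    exact ⟨⟨y, by omega⟩, ⟨Nat.le_of_lt_succ hy, fun k hk h => hy' k hk (by rw [h])⟩, rfl⟩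

end Extend

theorem permOfGapless_of_carrelStart_eq_zero (γ : Fin n → Fin n) (i : Fin n)
    (h : carrelStart R i = 0) : permOfGapless R γ i = γ i := by
  rw [permOfGapless]
  simp only [h, if_true]

theorem permOfGapless_eq (γ : Fin n → Fin n) {i a b : Fin n} (hb : (b : ℕ) = carrelStart R i)
    (hab : (a : ℕ) + 1 = b) {s : ℕ} (hs : s = if γ b ≤ γ a then (γ a : ℕ) - γ b + 1 else 0) :
    permOfGapless R γ i = if (i : ℕ) < b + s then
      rank (Iic (γ a) \ (univ : Finset {j : Fin n // (j : ℕ) < b}).image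
        (fun j => permOfGapless R γ j.1)) (b + s - i) else γ i := by
  have hin := carrelStart_le R i
  have h1 : carrelStart R i < n := lt_of_le_of_lt hin i.isLt
  have h2 : carrelStart R i - 1 < n := lt_of_le_of_lt (Nat.sub_le _ _) h1
  have h0 : carrelStart R i ≠ 0 := by omega
  have hb' : b = ⟨carrelStart R i, h1⟩ := Fin.ext hb
  have ha' : a = ⟨carrelStart R i - 1, h2⟩ := Fin.ext (by simp only; omega)
  clear hb hab
  subst hs ha' hb'
  rw [permOfGapless]
  simp only
  rw [if_neg h0]

/-- The third clause says that `γ` is the rank tuple of the permutation so far. The induction needs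
it: at the last index of a carrel it makes the entry of `γ` the maximum of the prefix, so that
enough missing values lie below it. -/
theorem IsGapless.permOfGapless_prefix {γ : Fin n → Fin n} (hγ : IsGapless R γ) (e : ℕ)
    (he0 : 0 < e) (heR : e ∈ R ∨ e = n) (hen : e ≤ n) :
    (∀ i j : Fin n, i < j → (j : ℕ) < e → SameCarrel R i j →
      permOfGapless R γ i < permOfGapless R γ j) ∧
    (∀ i j : Fin n, (i : ℕ) < e → (j : ℕ) < e → permOfGapless R γ i = permOfGapless R γ j →
      i = j) ∧
    (∀ i : Fin n, (i : ℕ) < e →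
      (γ i : ℕ) ∈ prefixSet (permOfGapless R γ) (carrelEnd R n i) ∧
      countGe (prefixSet (permOfGapless R γ) (carrelEnd R n i)) (γ i) = carrelEnd R n i - i) ∧
    (∀ q ∈ R, q ≤ e →
      PairAvoids (prefixSet (permOfGapless R γ) q) (prefixSet (permOfGapless R γ) e)) := by
  induction e using Nat.strong_induction_on with
  | _ e ih =>
    set π := permOfGapless R γ with hπ
    have hqe := carrelStart_le R (e - 1)
    obtain ⟨hE, hE'⟩ := carrelEnd_carrelStart (R := R) (n := n) (i := e - 1) (by omega)
    have hEe : carrelEnd R n (e - 1) = e := by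
      have h1 := lt_carrelEnd (R := R) (n := n) (i := e - 1) (by omega)
      rcases heR with h | h
      · have := carrelEnd_le_of_mem (n := n) h (show e - 1 < e by omega)
        omega
      · have := carrelEnd_le R n (e - 1)
        omega
    have hqR := carrelStart_mem R (e - 1)
    set q := carrelStart R (e - 1) with hq
    rw [hEe] at hE
    have hcE : ∀ i : ℕ, q ≤ i → i < e → carrelEnd R n i = e := fun i hi hi' => by
      rw [carrelEnd_eq hi (by omega), hE]
    have hinc : ∀ i j : Fin n, q ≤ i → i < j → (j : ℕ) < e → γ i < γ j := by
      intro i j hi hij hj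
      refine hγ.1 i j hij ((sameCarrel_iff hij.le j.isLt).mpr ?_)
      rw [Fin.lt_def] at hij
      rw [hcE i hi (by omega)]
      exact hj
    -- The first carrel uses `U = s = 0`, and a later one uses `U = γ a + 1` with `a` the last index
    -- of the previous carrel.
    have hstep : (∀ i j : Fin n, (i : ℕ) < q → (j : ℕ) < q → π i = π j → i = j) ∧
        ∃ U s, q + s ≤ e ∧ q + s ≤ U ∧ prefixSet π q ⊆ range U ∧
        (∀ i : Fin n, q ≤ i → (i : ℕ) < q + s →
          (π i : ℕ) = rank (range U \ prefixSet π q) (q + s - i)) ∧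
        (∀ i : Fin n, q + s ≤ i → (i : ℕ) < e → π i = γ i) ∧
        (∀ i : Fin n, q ≤ i → (i : ℕ) < q + s → (γ i : ℕ) + (q + s) = U + i) ∧
        (∀ i : Fin n, q + s ≤ i → (i : ℕ) < e → U ≤ γ i) := by
      by_cases hq0 : q = 0
      · rw [hq0]
        refine ⟨fun i j hi => absurd hi (Nat.not_lt_zero _), 0, 0, by omega, by omega, ?_,
          fun i _ hi => absurd hi (by omega), ?_, fun i _ hi => absurd hi (by omega),
          fun i _ _ => Nat.zero_le _⟩
        · intro y hy
          obtain ⟨k, hk, -⟩ := mem_prefixSet.mp hy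
          omega
        · intro i _ hi
          refine permOfGapless_of_carrelStart_eq_zero γ i ?_
          by_contra hne
          have h1 := carrelEnd_le_of_mem (n := n) (carrelStart_mem R i hne)
            (show q < carrelStart R i by omega)
          have h2 := carrelStart_le R i
          omega
      · have hqR := hqR hq0
        obtain ⟨-, hinj, hent, -⟩ := ih q (by omega) (by omega) (Or.inl hqR) (by omega)
        refine ⟨hinj, ?_⟩
        have hcard := card_prefixSet_of_injOn (by omega) hinj
        obtain ⟨a, ha⟩ : ∃ a : Fin n, (a : ℕ) + 1 = q := ⟨⟨q - 1, by omega⟩, by simp only; omega⟩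
        obtain ⟨b, hb⟩ : ∃ b : Fin n, (b : ℕ) = q := ⟨⟨q, by omega⟩, rfl⟩
        have haE : carrelEnd R n a = q := by
          have h1 := carrelEnd_le_of_mem (n := n) hqR (show (a : ℕ) < q by omega)
          have h2 := lt_carrelEnd (R := R) a.isLt
          omega
        obtain ⟨hM, hMc⟩ := hent a (by omega)
        rw [haE] at hM hMc
        have hMmax := le_of_countGe_eq_one hM (by omega)
        have hUsub : prefixSet π q ⊆ range (γ a + 1) := fun y hy =>
          mem_range.mpr (Nat.lt_succ_of_le (hMmax y hy))
        have hcC : (range ((γ a : ℕ) + 1) \ prefixSet π q).card = γ a + 1 - q := by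
          rw [card_sdiff_of_subset hUsub, card_range, hcard]
        have hqa : q ≤ γ a + 1 := by
          have := card_le_card hUsub
          rw [card_range] at this
          omega
        have hbup : (b : ℕ) ≤ γ b := hγ.2.1 b
        obtain ⟨s, hs⟩ : ∃ s, s = if γ b ≤ γ a then (γ a : ℕ) - γ b + 1 else 0 := ⟨_, rfl⟩
        have hstart : ∀ i : Fin n, q ≤ i → (i : ℕ) < e → (b : ℕ) = carrelStart R i :=
          fun i hi hi' => by rw [hb, carrelStart_eq (n := n) hqR hi (by omega)]
        have hπi := fun (i : Fin n) (h1 : q ≤ i) (h2 : (i : ℕ) < e) =>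
          permOfGapless_eq γ (hstart i h1 h2) (by omega : (a : ℕ) + 1 = b) hs
        have hsU : q + s ≤ γ a + 1 := by
          split_ifs at hs with hle
          · rw [Fin.le_def] at hle
            omega
          · omega
        have hse : q + s ≤ e := by
          split_ifs at hs with hle
          · have := (isGapless_entry (c := b) hγ (hb ▸ hqR) (by omega) hle).1
            rw [hb, hE] at this
            omega
          · omega
        have hlow : ∀ i : Fin n, q ≤ i → (i : ℕ) < q + s → (γ i : ℕ) + (q + s) = γ a + 1 + i := by
          intro i hi his
          split_ifs at hs with hle
          · have := (isGapless_entry (c := i) hγ (hb ▸ hqR) (by omega) hle).2 (by omega)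
              (by rw [Fin.le_def]; omega)
            rw [Fin.le_def] at hle
            omega
          · omega
        refine ⟨γ a + 1, s, hse, hsU, hUsub, ?_, ?_, hlow, ?_⟩
        · intro i hi his
          rw [hπ, hπi i hi (by omega), if_pos (by omega), ← hπ, hb]
          have := image_val_Iic_sdiff π (γ a) q
          rw [val_rank, this]
          · omega
          · rw [← card_image_of_injective _ Fin.val_injective, this]
            omega
        · intro i hi hie
          rw [hπ, hπi i (by omega) hie, if_neg (by omega)]
        · intro i hi hie
          rcases Nat.eq_zero_or_pos s with h0 | h0
          · split_ifs at hs with hle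
            · omega
            · have h1 : γ b ≤ γ i := by
                rcases (show (b : ℕ) ≤ i by omega).eq_or_lt with h | h
                · rw [Fin.ext h]
                · exact (hinc b i (by omega) h hie).le
              rw [Fin.le_def] at h1 hle
              omega
          · obtain ⟨c, hc⟩ : ∃ c : Fin n, (c : ℕ) + 1 = q + s :=
              ⟨⟨q + s - 1, by omega⟩, by simp only; omega⟩
            have h1 := hlow c (by omega) (by omega)
            have h2 := hinc c i (by omega) (by rw [Fin.lt_def]; omega) hie
            rw [Fin.lt_def] at h2
            omega
    obtain ⟨hinj, U, s, hqs, hU, hB, H1, H2, H3, H4⟩ := hstep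
    obtain ⟨r1, r2, r3, r4⟩ := extend_carrel hqs hen hU hB hinj hinc H1 H2 H3 H4
    refine ⟨?_, r2, ?_, ?_⟩
    · intro i j hij hj hc
      by_cases hiq : (i : ℕ) < q
      · have hqR := hqR (by omega)
        refine (ih q (by omega) (by omega) (Or.inl hqR) (by omega)).1 i j hij ?_ hc
        have h1 := (sameCarrel_iff hij.le j.isLt).mp hc
        have h2 := carrelEnd_le_of_mem (n := n) hqR hiq
        omega
      · exact r1 i j (not_lt.mp hiq) hij hj
    · intro i hi
      by_cases hiq : (i : ℕ) < q
      · exact (ih q (by omega) (by omega) (Or.inl (hqR (by omega))) (by omega)).2.2.1 i hiq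
      · rw [hcE i (not_lt.mp hiq) hi]
        exact r3 i (not_lt.mp hiq) hi
    · intro q' hq' hq'e
      rcases lt_trichotomy q' q with h | h | h
      · have := (ih q (by omega) (by omega) (Or.inl (hqR (by omega))) (by omega)).2.2.2 q' hq' h.le
        exact this.trans r4 (prefixSet_mono _ h.le) (prefixSet_mono _ (by omega))
      · rw [h]
        exact r4
      · have := carrelEnd_le_of_mem (n := n) hq' h
        obtain rfl : q' = e := by omega
        exact fun a _ b hb hb' => absurd hb hb'

theorem IsGapless.isAvoiding_permOfGapless {γ : Fin n → Fin n} (hγ : IsGapless R γ) :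
    IsAvoiding R (permOfGapless R γ) := by
  obtain ⟨h1, h2, -, -⟩ := hγ.permOfGapless_prefix n (NeZero.pos n) (Or.inr rfl) le_rfl
  have hinj : Function.Injective (permOfGapless R γ) := fun i j => h2 i j i.isLt j.isLt
  refine ⟨⟨hinj, fun i j hij hc => h1 i j hij j.isLt hc⟩, ?_⟩
  rintro ⟨q, hq, q', hq', a, b, c, haq, hqb, hbq, hqc, hbc, hca⟩
  obtain ⟨-, -, -, h4⟩ := hγ.permOfGapless_prefix q' (by omega) (Or.inl hq') (by omega)
  exact notMem_prefixSet hinj hqc (h4 q hq (by omega) _ (mem_prefixSet.mpr ⟨a, haq, rfl⟩) _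
    (mem_prefixSet.mpr ⟨b, hbq, rfl⟩) (notMem_prefixSet hinj hqb) _ hbc hca)

theorem IsGapless.rankTuple_permOfGapless {γ : Fin n → Fin n} (hγ : IsGapless R γ) :
    rankTuple R (permOfGapless R γ) = γ := by
  obtain ⟨-, -, h3, -⟩ := hγ.permOfGapless_prefix n (NeZero.pos n) (Or.inr rfl) le_rfl
  funext i
  obtain ⟨h, h'⟩ := h3 i i.isLt
  rw [Fin.ext_iff, val_rankTuple R hγ.isAvoiding_permOfGapless.1.1]
  exact rank_eq_of_countGe h h'

end Perm

/-! ### Row bound sets and Demazure sets -/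

section Shape

variable {n : ℕ} {μ : YoungDiagram}

theorem colLen_mem_dividers (hμ : μ.colLen 0 ≤ n) {j : ℕ} (hj : j < μ.rowLen 0) :
    μ.colLen j ∈ dividers n μ ∨ μ.colLen j = n := by
  have h := (μ.colLen_anti 0 j (Nat.zero_le j)).trans hμ
  rcases h.eq_or_lt with h | h
  · exact Or.inr h
  · exact Or.inl (mem_filter.mpr ⟨mem_image_of_mem _ (mem_range.mpr hj), h⟩)

theorem carrelEnd_le_colLen (hμ : μ.colLen 0 ≤ n) {i j : ℕ} (h : (i, j) ∈ μ) :
    carrelEnd (dividers n μ) n i ≤ μ.colLen j := by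
  rcases colLen_mem_dividers hμ (lt_rowLen_zero h) with h' | h'
  · exact carrelEnd_le_of_mem h' (YoungDiagram.mem_iff_lt_colLen.mp h)
  · exact (carrelEnd_le _ _ _).trans h'.ge

theorem lt_of_mem_shape (hμ : μ.colLen 0 ≤ n) {i j : ℕ} (h : (i, j) ∈ μ) : i < n :=
  (YoungDiagram.mem_iff_lt_colLen.mp h).trans_le ((μ.colLen_anti 0 j (Nat.zero_le j)).trans hμ)

/-- The last column that meets row `i` ends at the end of the carrel of `i`. -/
theorem exists_last_column (hμ : μ.colLen 0 ≤ n) {i j : ℕ} (h : (i, j) ∈ μ) :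
    ∃ l, j ≤ l ∧ (i, l) ∈ μ ∧ μ.colLen l = carrelEnd (dividers n μ) n i := by
  have hj := YoungDiagram.mem_iff_lt_rowLen.mp h
  have hl : (i, μ.rowLen i - 1) ∈ μ := YoungDiagram.mem_iff_lt_rowLen.mpr (by omega)
  refine ⟨μ.rowLen i - 1, by omega, hl, le_antisymm ?_ (carrelEnd_le_colLen hμ hl)⟩
  have hi := lt_carrelEnd (R := dividers n μ) (lt_of_mem_shape hμ hl)
  rcases carrelEnd_mem (dividers n μ) n i with h' | h'
  · obtain ⟨k, hk, hk'⟩ := mem_image.mp (mem_filter.mp h').1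
    rw [← hk'] at hi ⊢
    have := YoungDiagram.mem_iff_lt_rowLen.mp (YoungDiagram.mem_iff_lt_colLen.mpr hi)
    exact μ.colLen_anti _ _ (by omega)
  · exact ((μ.colLen_anti 0 _ (Nat.zero_le _)).trans hμ).trans h'.ge

/-- A column that meets row `i` also meets row `j`, since columns do not end inside a carrel. Column
strictness then brings the bound `β j` up to the bound `γ i`. This serves both cores and running
maxima. -/
theorem rowBoundSet_eq {β γ : Fin n → Fin n} (hμ : μ.colLen 0 ≤ n) (hγ : IsUpper γ)
    (hle : ∀ i, γ i ≤ β i)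
    (h : ∀ i : Fin n, ∃ j : Fin n, i ≤ j ∧ (j : ℕ) < carrelEnd (dividers n μ) n i ∧
      (β j : ℕ) = γ i + (j - i)) : rowBoundSet μ β = rowBoundSet μ γ := by
  ext T
  constructor
  · rintro ⟨-, hT⟩
    refine ⟨hγ, fun i l hil => ?_⟩
    obtain ⟨j, hij, hj, hβ⟩ := h i
    have hjl : ((j : ℕ), l) ∈ μ :=
      YoungDiagram.mem_iff_lt_colLen.mpr (hj.trans_le (carrelEnd_le_colLen hμ hil))
    have h1 := entry_add_le T.1 (Fin.le_def.mp hij) hjl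
    have h2 := hT j l hjl
    omega
  · rintro ⟨-, hT⟩
    exact ⟨fun i => (hγ i).trans (hle i), fun i l hil => (hT i l hil).trans (hle i)⟩

theorem rowBoundSet_core (hμ : μ.colLen 0 ≤ n) {υ : Fin n → Fin n} (hυ : IsUpper υ) :
    rowBoundSet μ υ = rowBoundSet μ (core (dividers n μ) υ) := by
  refine rowBoundSet_eq hμ (isUpper_core _ hυ) (core_le hυ) (fun i => ?_)
  obtain ⟨j, hij, hj, h⟩ := exists_core_add_eq (dividers n μ) hυ i
  exact ⟨j, hij, hj, h.symm⟩

theorem IsGapless.rowBoundSet_runningMax (hμ : μ.colLen 0 ≤ n) {γ : Fin n → Fin n}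
    (hγ : IsGapless (dividers n μ) γ) : rowBoundSet μ (runningMax γ) = rowBoundSet μ γ :=
  rowBoundSet_eq hμ hγ.2.1 (le_runningMax γ) hγ.exists_runningMax_eq

theorem le_keyEntry_iff (hμ : μ.colLen 0 ≤ n) {π : Fin n → Fin n} (hπ : Function.Injective π)
    {i j v : ℕ} (h : (i, j) ∈ μ) :
    v ≤ keyEntry μ π i j ↔ μ.colLen j - i ≤ countGe (prefixSet π (μ.colLen j)) v := by
  have hi := YoungDiagram.mem_iff_lt_colLen.mp h
  refine le_rank_iff (by omega) ?_
  have := card_prefixSet hπ ((μ.colLen_anti 0 j (Nat.zero_le j)).trans hμ)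
  unfold prefixSet at this
  omega

/-- A tableau that is bounded row by row by the rank tuple is bounded by the key. -/
theorem le_countGe_of_mem_rowBoundSet [NeZero n] (hμ : μ.colLen 0 ≤ n) {π : Fin n → Fin n}
    (hπ : IsAvoiding (dividers n μ) π) {T : Tableau n μ}
    (hT : T ∈ rowBoundSet μ (rankTuple (dividers n μ) π)) {i l : ℕ} (h : (i, l) ∈ μ) :
    μ.colLen l - i ≤ countGe (prefixSet π (μ.colLen l)) (T.1 i l) := by
  have hinj := hπ.1.1
  have hgn := (μ.colLen_anti 0 l (Nat.zero_le l)).trans hμ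
  obtain ⟨m, hm⟩ : ∃ m, m = μ.colLen l - i := ⟨_, rfl⟩
  induction m using Nat.strong_induction_on generalizing i with
  | _ m ih =>
    have hil := YoungDiagram.mem_iff_lt_colLen.mp h
    have hi := lt_of_mem_shape hμ h
    have hrow := (le_rankTuple_iff hinj).mp (hT.2 ⟨i, hi⟩ l h)
    simp only at hrow
    have hie := lt_carrelEnd (R := dividers n μ) hi
    have heg := carrelEnd_le_colLen hμ h
    have heR := carrelEnd_mem (dividers n μ) n i
    set e := carrelEnd (dividers n μ) n i
    rcases heg.eq_or_lt with heg | heg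
    · rwa [heg] at hrow
    · have hel : (e, l) ∈ μ := YoungDiagram.mem_iff_lt_colLen.mpr heg
      have h1 := ih (μ.colLen l - e) (by omega) hel rfl
      have h2 := entry_add_le T.1 hie.le hel
      have h3 := countGe_anti (prefixSet π (μ.colLen l)) h2
      -- The row bound controls the prefix that ends at the carrel end `e`, and the induction
      -- controls the same column from row `e` on. Avoidance combines the two counts.
      have h4 := (pairAvoids_prefixSet hinj hπ.2 heR
        (colLen_mem_dividers hμ (lt_rowLen_zero h))).le_countGe (prefixSet_mono π heg.le) hrow
        (t := μ.colLen l - e) (d := e - i)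
        (by rw [card_prefixSet hinj (by omega), card_prefixSet hinj hgn]; omega) le_rfl (by omega)
      omega

/-- The Demazure set of an avoiding permutation is the row bound set of its rank tuple. -/
theorem IsAvoiding.demazureSet_eq [NeZero n] (hμ : μ.colLen 0 ≤ n) {π : Fin n → Fin n}
    (hπ : IsAvoiding (dividers n μ) π) :
    demazureSet μ π = rowBoundSet μ (rankTuple (dividers n μ) π) := by
  have hinj := hπ.1.1
  have hcol : ∀ l, μ.colLen l ≤ n := fun l => (μ.colLen_anti 0 l (Nat.zero_le l)).trans hμ
  ext T
  constructor
  · intro hT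
    refine ⟨hπ.isGapless_rankTuple.2.1, fun i j hij => ?_⟩
    obtain ⟨l, hjl, hil, hl⟩ := exists_last_column hμ hij
    refine (T.1.row_weak_of_le hjl hil).trans ?_
    have h1 := (le_scanEntry T.1 hil).trans (hT i l hil)
    rw [le_keyEntry_iff hμ hinj hil, hl] at h1
    exact (le_rankTuple_iff hinj).mpr h1
  · intro hT i j hij
    have hi := YoungDiagram.mem_iff_lt_colLen.mp hij
    rw [le_keyEntry_iff hμ hinj hij, scanEntry_eq]
    have := le_countGe_passValue T.1 (prefixSet π) (fun l _ => card_prefixSet hinj (hcol l))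
      (fun l m hlm _ => prefixSet_mono π (μ.colLen_anti l m hlm))
      (fun l m hlm hm => pairAvoids_prefixSet hinj hπ.2 (colLen_mem_dividers hμ hm)
        (colLen_mem_dividers hμ (lt_of_le_of_lt hlm hm)))
      (fun i l hil => le_countGe_of_mem_rowBoundSet hμ hπ hT hil)
      (lt_rowLen_zero hij).le le_rfl (lt_rowLen_zero hij) (μ.colLen j - 1 - i) (by omega)
    exact le_trans (by omega) this

/-! ### Keys, and recovering the permutation -/

theorem keyEntry_mem (hμ : μ.colLen 0 ≤ n) {π : Fin n → Fin n} (hπ : Function.Injective π)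
    {i j : ℕ} (h : (i, j) ∈ μ) : keyEntry μ π i j ∈ prefixSet π (μ.colLen j) := by
  have hi := YoungDiagram.mem_iff_lt_colLen.mp h
  have := card_prefixSet hπ ((μ.colLen_anti 0 j (Nat.zero_le j)).trans hμ)
  exact (rank_mem_and_countGe (Q := prefixSet π (μ.colLen j)) (by omega) (by omega)).1

open Classical in
/-- The key of a permutation, as a tableau. -/
noncomputable def keyTableau (hμ : μ.colLen 0 ≤ n) {π : Fin n → Fin n}
    (hπ : Function.Injective π) : Tableau n μ :=
  ⟨{ entry := fun i j => if (i, j) ∈ μ then keyEntry μ π i j else 0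
     row_weak' := by
      intro i j₁ j₂ hj h
      have h' := μ.up_left_mem le_rfl hj.le h
      have hc := fun l => card_prefixSet hπ ((μ.colLen_anti 0 l (Nat.zero_le l)).trans hμ)
      have hi := YoungDiagram.mem_iff_lt_colLen.mp h
      simp only [h, h', if_true]
      rw [le_keyEntry_iff hμ hπ h]
      have h1 := (le_keyEntry_iff hμ hπ h').mp le_rfl
      -- Passing to the shorter column loses at most the difference of the lengths from the count.
      have h2 := countGe_le_add (prefixSet_mono π (μ.colLen_anti j₁ j₂ hj.le))
        (keyEntry μ π i j₁)
      rw [hc, hc] at h2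
      have := μ.colLen_anti j₁ j₂ hj.le
      omega
     col_strict' := by
      intro i₁ i₂ j hi h
      have h' := μ.up_left_mem hi.le le_rfl h
      have hi' := YoungDiagram.mem_iff_lt_colLen.mp h
      have hc := card_prefixSet hπ ((μ.colLen_anti 0 j (Nat.zero_le j)).trans hμ)
      simp only [h, h', if_true]
      refine rank_lt_rank (by omega) (by omega) ?_
      unfold prefixSet at hc
      omega
     zeros' := fun h => if_neg h },
    fun i j h => by
      obtain ⟨k, -, hk⟩ := mem_prefixSet.mp (keyEntry_mem hμ hπ h)
      change (if (i, j) ∈ μ then keyEntry μ π i j else 0) < n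
      rw [if_pos h, ← hk]
      exact (π k).isLt⟩

theorem keyTableau_entry (hμ : μ.colLen 0 ≤ n) {π : Fin n → Fin n} (hπ : Function.Injective π)
    {i j : ℕ} (h : (i, j) ∈ μ) : (keyTableau hμ hπ).1 i j = keyEntry μ π i j :=
  if_pos h

theorem keyTableau_mem_demazureSet (hμ : μ.colLen 0 ≤ n) {π : Fin n → Fin n}
    (hπ : Function.Injective π) : keyTableau hμ hπ ∈ demazureSet μ π := by
  intro i j hij
  have hi := YoungDiagram.mem_iff_lt_colLen.mp hij
  rw [le_keyEntry_iff hμ hπ hij, scanEntry_eq]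
  have := le_countGe_passValue_of_mem (keyTableau hμ hπ).1 (prefixSet π (μ.colLen j))
    (fun i l hjl hil => by
      rw [keyTableau_entry hμ hπ hil]
      exact prefixSet_mono π (μ.colLen_anti j l hjl) (keyEntry_mem hμ hπ hil))
    (lt_rowLen_zero hij) (k := μ.colLen j - 1 - i) (by omega)
  exact le_trans (by omega) this

/-- A permutation is determined by its Demazure set. -/
theorem IsRPerm.eq_of_demazureSet_eq (hμ : μ.colLen 0 ≤ n) {π π' : Fin n → Fin n}
    (hπ : IsRPerm (dividers n μ) π) (hπ' : IsRPerm (dividers n μ) π')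
    (h : demazureSet μ π = demazureSet μ π') : π = π' := by
  have key : ∀ {π π' : Fin n → Fin n}, Function.Injective π →
      demazureSet μ π = demazureSet μ π' → ∀ i j, (i, j) ∈ μ →
      keyEntry μ π i j ≤ keyEntry μ π' i j := by
    intro π π' hπ h i j hij
    have hmem := keyTableau_mem_demazureSet hμ hπ
    rw [h] at hmem
    rw [← keyTableau_entry hμ hπ hij]
    exact (le_scanEntry _ hij).trans (hmem i j hij)
  refine hπ.eq_of_prefixSet_eq hπ' (fun q hq => ?_)
  rcases hq with hq | rfl
  · obtain ⟨hq, hqn⟩ := mem_filter.mp hq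
    obtain ⟨j, -, rfl⟩ := mem_image.mp hq
    have hc := card_prefixSet hπ.1 hqn.le
    have hc' := card_prefixSet hπ'.1 hqn.le
    refine eq_of_rank_eq (hc.trans hc'.symm) (fun d hd hd' => ?_)
    rw [hc] at hd'
    have hij : (μ.colLen j - d, j) ∈ μ := YoungDiagram.mem_iff_lt_colLen.mpr (by omega)
    have := le_antisymm (key hπ.1 h _ _ hij) (key hπ'.1 h.symm _ _ hij)
    unfold keyEntry at this
    rw [show μ.colLen j - (μ.colLen j - d) = d by omega] at this
    exact this
  -- The full prefix carries no information, so a shape without a column of length `n` loses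
  -- nothing.
  · have hall : ∀ {π : Fin q → Fin q}, Function.Injective π → prefixSet π q = range q := by
      intro π hπ
      refine eq_of_subset_of_card_le (fun y hy => ?_) ?_
      · obtain ⟨k, -, rfl⟩ := mem_prefixSet.mp hy
        exact mem_range.mpr (π k).isLt
      · rw [card_range, card_prefixSet hπ le_rfl]
    rw [hall hπ.1, hall hπ'.1]

/-- The row bound set of a gapless core tuple is a Demazure set. -/
theorem IsGaplessCore.rowBoundSet_eq [NeZero n] (hμ : μ.colLen 0 ≤ n) {η : Fin n → Fin n}
    (hη : IsGaplessCore (dividers n μ) η) : rowBoundSet μ η =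
      demazureSet μ (permOfGapless (dividers n μ) (core (dividers n μ) η)) := by
  rw [rowBoundSet_core hμ hη.1, hη.2.isAvoiding_permOfGapless.demazureSet_eq hμ,
    hη.2.rankTuple_permOfGapless]

theorem tableauSum_mk_inj {μ : YoungDiagram} {A B : Set (Tableau n μ)}
    (h : (⟨μ, A⟩ : TableauSum n) = ⟨μ, B⟩) : A = B := by
  simpa using h

end Shape

end FlagDemazure

/-! ### The main theorem -/

open FlagDemazure
theorem mainTheorem6 (n : ℕ) [NeZero n] (μ : YoungDiagram) (hμ : μ.colLen 0 ≤ n) :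
    (∀ η : Fin n → Fin n, IsGaplessCore (dividers n μ) η →
      IsAvoiding (dividers n μ) (permOfGapless (dividers n μ) (core (dividers n μ) η)) ∧
      Identical (rowBoundSum μ η)
        (demazureSum μ (permOfGapless (dividers n μ) (core (dividers n μ) η))) ∧
      (rowBoundSum μ η).poly =
        (demazureSum μ (permOfGapless (dividers n μ) (core (dividers n μ) η))).poly) ∧
    (∀ π : Fin n → Fin n, IsAvoiding (dividers n μ) π →
      IsGapless (dividers n μ) (rankTuple (dividers n μ) π) ∧
      Identical (demazureSum μ π) (rowBoundSum μ (rankTuple (dividers n μ) π)) ∧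
      (demazureSum μ π).poly = (rowBoundSum μ (rankTuple (dividers n μ) π)).poly) ∧
    (∀ φ : Fin n → Fin n, IsUpperFlag φ →
      ∃! p : YoungDiagram × (Fin n → Fin n),
        p.1.colLen 0 ≤ n ∧ IsRPerm (dividers n p.1) p.2 ∧
        Identical (rowBoundSum μ φ) (demazureSum p.1 p.2)) ∧
    (∀ π : Fin n → Fin n, IsAvoiding (dividers n μ) π →
      ∃ φ : Fin n → Fin n, IsUpperFlag φ ∧ Identical (demazureSum μ π) (rowBoundSum μ φ) ∧
        ∀ (ν : YoungDiagram) (φ' : Fin n → Fin n), ν.colLen 0 ≤ n → IsUpperFlag φ' →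
          Identical (demazureSum μ π) (rowBoundSum ν φ') →
            ν = μ ∧ core (dividers n μ) φ' = core (dividers n μ) φ) := by
  have hI : ∀ η : Fin n → Fin n, IsGaplessCore (dividers n μ) η → rowBoundSum μ η =
      demazureSum μ (permOfGapless (dividers n μ) (core (dividers n μ) η)) := fun η hη =>
    congrArg (TableauSum.mk μ) (hη.rowBoundSet_eq hμ)
  have hII : ∀ π : Fin n → Fin n, IsAvoiding (dividers n μ) π →
      demazureSum μ π = rowBoundSum μ (rankTuple (dividers n μ) π) := fun π hπ =>
    congrArg (TableauSum.mk μ) (hπ.demazureSet_eq hμ)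
  have hflag : ∀ φ : Fin n → Fin n, IsUpperFlag φ → IsGaplessCore (dividers n μ) φ :=
    fun φ hφ => ⟨hφ.1, hφ.isGapless_core _⟩
  refine ⟨fun η hη => ⟨hη.2.isAvoiding_permOfGapless, hI η hη, congrArg _ (hI η hη)⟩,
    fun π hπ => ⟨hπ.isGapless_rankTuple, hII π hπ, congrArg _ (hII π hπ)⟩, fun φ hφ => ?_,
    fun π hπ => ?_⟩
  · have hφ' := hflag φ hφ
    refine ⟨(μ, permOfGapless (dividers n μ) (core (dividers n μ) φ)),
      ⟨hμ, hφ'.2.isAvoiding_permOfGapless.1, hI φ hφ'⟩, ?_⟩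
    rintro ⟨ν, π⟩ ⟨hν, hπ, h⟩
    simp only at hν hπ h
    obtain rfl : μ = ν := congrArg TableauSum.shape h
    have h' := tableauSum_mk_inj ((hI φ hφ').symm.trans h)
    rw [hφ'.2.isAvoiding_permOfGapless.1.eq_of_demazureSet_eq hμ hπ h']
  · have hγ := hπ.isGapless_rankTuple
    have hφ := isUpperFlag_runningMax hγ.2.1
    have hD : demazureSum μ π = rowBoundSum μ (runningMax (rankTuple (dividers n μ) π)) := by
      rw [hII π hπ]
      exact congrArg (TableauSum.mk μ) (hγ.rowBoundSet_runningMax hμ).symm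
    refine ⟨_, hφ, hD, fun ν φ' hν hφ' h => ?_⟩
    obtain rfl : μ = ν := congrArg TableauSum.shape h
    refine ⟨rfl, ?_⟩
    have h1 := hflag _ hφ
    have h2 := hflag _ hφ'
    have h3 := tableauSum_mk_inj ((hI _ h2).symm.trans (h.symm.trans (hD.trans (hI _ h1))))
    have h4 := h2.2.isAvoiding_permOfGapless.1.eq_of_demazureSet_eq hμ
      h1.2.isAvoiding_permOfGapless.1 h3
    -- Equal permutations have equal rank tuples, and these are the two cores.
    rw [← h2.2.rankTuple_permOfGapless, h4, h1.2.rankTuple_permOfGapless]
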